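/- Let $\alpha,\theta\ge 0$ and $x,\mu\in\mathbb R$. For $\sigma>0$ consider, on $[0,\infty)$, the system of ODEs $$\dot m_\sigma=-m_\sigma^3+m_\sigma-\nu_\sigma-3\sigma^2m_\sigma V_\sigma,\qquad \dot\nu_\sigma=-\alpha\nu_\sigma-\theta\,\dot m_\sigma,\qquad \dot V_\sigma=1+2(1-3m_\sigma^2)V_\sigma-6\sigma^2V_\sigma^2,$$ with $m_\sigma(0)=x$, $\nu_\sigma(0)=\mu$, $V_\sigma(0)=0$. It has a global solution. Given a standard Brownian motion $B$ on a probability space, the linear SDE $$dz_\sigma(t)=\bigl[1-3m_\sigma^2(t)-3\sigma^2V_\sigma(t)\bigr]z_\sigma(t)\,dt+dB(t),\qquad z_\sigma(0)=0,$$ has a strong solution. For every such solution put $y_\sigma(t):=m_\sigma(t)+\sigma z_\sigma(t)$. Then the following hold. (a) $y_\sigma$ is a Gaussian process and a Markov process, $\nu_\sigma$ is deterministic, $y_\sigma(0)=x$ almost surely and $\nu_\sigma(0)=\mu$. (b) The moments $M_k(t):=\mathbb E[y_\sigma(t)^k]$ ($0\le k\le 4$) are finite, and for $k=1,2$ and all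 $t\ge 0$ $$\frac{dM_k}{dt}=-kM_{k+2}+kM_k+\frac{\sigma^2}{2}k(k-1)M_{k-2}-k\,\nu_\sigma M_{k-1},$$ $$\frac{d\nu_\sigma}{dt}=-(\alpha-\theta)\nu_\sigma-\theta(-M_3+M_1)=-\alpha\nu_\sigma-\theta\frac{dM_1}{dt}$$ (for $k=1$ the term with $M_{k-2}$ is absent). (c) For every $T>0$ there is a constant $C_T$, depending only on $T,\alpha,\theta,x,\mu$, such that for all $\sigma>0$ and every strong solution $(x_\sigma,\mu_\sigma)$, driven by the same Brownian motion $B$, of the McKean–Vlasov system $$dx_\sigma=(-x_\sigma^3+x_\sigma)\,dt-\mu_\sigma\,dt+\sigma\,dB,\qquad \frac{d\mu_\sigma}{dt}=-(\alpha-\theta)\mu_\sigma+\theta\,\mathbb E\bigl[x_\sigma^3-x_\sigma\bigr],\qquad x_\sigma(0)=x,\ \mu_\sigma(0)=\mu,$$ one has $$\mathbb E\Bigl[\sup_{t\in[0,T]}|x_\sigma(t)-y_\sigma(t)|\Bigr]+\sup_{t\in[0,T]}|\mu_\sigma(t)-\nu_\sigma(t)|\le C_T\,\sigma^2 .$$ 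-/

import Mathlib

open MeasureTheory ProbabilityTheory Set
open scoped NNReal ENNReal

noncomputable section

/-- The σ-algebra `σ(X r : r ≤ t)` generated by the process `X` up to time `t`. -/
abbrev pastSigma {Ω : Type*} (X : ℝ≥0 → Ω → ℝ) (t : ℝ≥0) : MeasurableSpace Ω :=
  ⨆ r ≤ t, MeasurableSpace.comap (X r) inferInstance

/-- A real process is Markov (with respect to its own filtration): for `s ≤ t` and `A` Borel,
`P(X t ∈ A | X r, r ≤ s) = P(X t ∈ A | X s)` almost surely. -/
structure IsMarkovReal {Ω : Type*} [MeasurableSpace Ω] (X : ℝ≥0 → Ω → ℝ) (P : Measure Ω) :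
    Prop where
  measurable : ∀ t, Measurable (X t)
  markov : ∀ s t : ℝ≥0, s ≤ t → ∀ A : Set ℝ, MeasurableSet A →
    P[(X t ⁻¹' A).indicator (fun _ ↦ (1 : ℝ)) | pastSigma X s]
      =ᵐ[P] P[(X t ⁻¹' A).indicator (fun _ ↦ (1 : ℝ)) |
        MeasurableSpace.comap (X s) inferInstance]

/-- `X` is a strong solution on `[0, ∞)` of `dX(t) = b(t, X(t)) dt + σ dB(t)`, `X(0) = x₀`:
it is adapted to the `P`-completed filtration of `B`, has almost surely continuous paths, and
almost surely satisfies the integral equation at all times. As the diffusion coefficient is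
constant, the stochastic integral is `σ B(t)`. -/
structure IsStrongSolution {Ω : Type*} [MeasurableSpace Ω] (P : Measure Ω) (B : ℝ≥0 → Ω → ℝ)
    (b : ℝ → ℝ → ℝ) (σ x₀ : ℝ) (X : ℝ≥0 → Ω → ℝ) : Prop where
  measurable : ∀ t, Measurable (X t)
  adapted : ∀ t, AEStronglyMeasurable[pastSigma B t] (X t) P
  continuous_paths : ∀ᵐ ω ∂P, Continuous fun t ↦ X t ω
  drift_integrable : ∀ᵐ ω ∂P, ∀ t : ℝ≥0,
    IntervalIntegrable (fun s : ℝ ↦ b s (X s.toNNReal ω)) volume 0 t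
  integral_eq : ∀ᵐ ω ∂P, ∀ t : ℝ≥0,
    X t ω = x₀ + (∫ s in (0 : ℝ)..t, b s (X s.toNNReal ω)) + σ * B t ω

/-- `(x, μ)` is a strong solution of the McKean–Vlasov system
`dx = (-x³ + x) dt - μ dt + σ dB`, `dμ/dt = -(α - θ) μ + θ E[x³ - x]`,
`x(0) = x₀`, `μ(0) = μ₀`. -/
structure IsMcKeanVlasovSolution {Ω : Type*} [MeasurableSpace Ω] (α θ σ x₀ μ₀ : ℝ)
    (P : Measure Ω) (B : ℝ≥0 → Ω → ℝ) (x : ℝ≥0 → Ω → ℝ) (μ : ℝ → ℝ) : Prop where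
  sde : IsStrongSolution P B (fun t u ↦ -u ^ 3 + u - μ t) σ x₀ x
  integrable : ∀ t : ℝ≥0, Integrable (fun ω ↦ x t ω ^ 3 - x t ω) P
  μ_zero : μ 0 = μ₀
  μ_deriv : ∀ t : ℝ≥0, HasDerivWithinAt μ
    (-(α - θ) * μ t + θ * ∫ ω, (x t ω ^ 3 - x t ω) ∂P) (Ici 0) t

/-- The right-hand side of the equation for `m`: `-m³ + m - ν - 3 σ² m V`. -/
def auxMeanDrift (σ m ν V : ℝ) : ℝ := -m ^ 3 + m - ν - 3 * σ ^ 2 * m * V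

/-- `(m, ν, V)` is a solution on `[0, ∞)` of
`m' = -m³ + m - ν - 3σ² m V`, `ν' = -α ν - θ m'`, `V' = 1 + 2 (1 - 3m²) V - 6σ² V²`,
`m(0) = x₀`, `ν(0) = μ₀`, `V(0) = 0`. -/
structure IsAuxSolution (α θ σ x₀ μ₀ : ℝ) (m ν V : ℝ → ℝ) : Prop where
  m_zero : m 0 = x₀
  ν_zero : ν 0 = μ₀
  V_zero : V 0 = 0
  m_deriv : ∀ t, 0 ≤ t →
    HasDerivWithinAt m (auxMeanDrift σ (m t) (ν t) (V t)) (Ici 0) t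
  ν_deriv : ∀ t, 0 ≤ t →
    HasDerivWithinAt ν (-α * ν t - θ * auxMeanDrift σ (m t) (ν t) (V t)) (Ici 0) t
  V_deriv : ∀ t, 0 ≤ t →
    HasDerivWithinAt V (1 + 2 * (1 - 3 * m t ^ 2) * V t - 6 * σ ^ 2 * V t ^ 2) (Ici 0) t

/-- `z` is a strong solution of `dz = [1 - 3 m² - 3σ² V] z dt + dB`, `z(0) = 0`. -/
def IsLinearSolution {Ω : Type*} [MeasurableSpace Ω] (σ : ℝ) (m V : ℝ → ℝ)
    (P : Measure Ω) (B : ℝ≥0 → Ω → ℝ) (z : ℝ≥0 → Ω → ℝ) : Prop :=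
  IsStrongSolution P B (fun t u ↦ (1 - 3 * m t ^ 2 - 3 * σ ^ 2 * V t) * u) 1 0 z

/-- The process `y = m + σ z`. -/
def gaussApprox {Ω : Type*} (σ : ℝ) (m : ℝ → ℝ) (z : ℝ≥0 → Ω → ℝ) : ℝ≥0 → Ω → ℝ :=
  fun t ω ↦ m t + σ * z t ω

/-- The `k`-th moment `E[Y(t)^k]`, as a function of the real variable `t ≥ 0`. -/
def moment_at {Ω : Type*} [MeasurableSpace Ω] (P : Measure Ω) (Y : ℝ≥0 → Ω → ℝ) (k : ℕ)
    (t : ℝ) : ℝ :=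
  ∫ ω, Y t.toNNReal ω ^ k ∂P

/-- The moments `M_j(t) = E[Y(t)^j]` and the function `ν` satisfy on `[0, ∞)` the `k`-th moment
equations (for `k ≥ 1`)
`M_k' = -k M_{k+2} + k M_k + (σ²/2) k (k-1) M_{k-2} - k ν M_{k-1}`,
`ν' = -(α - θ) ν - θ (-M_3 + M_1) = -α ν - θ M_1'`.
For `k = 1` the coefficient of `M_{k-2}` is zero. -/
structure SatisfiesMomentEquations {Ω : Type*} [MeasurableSpace Ω] (α θ σ : ℝ)
    (P : Measure Ω) (Y : ℝ≥0 → Ω → ℝ) (ν : ℝ → ℝ) (k : ℕ) : Prop where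
  integrable : ∀ j ≤ k + 2, ∀ t : ℝ≥0, Integrable (fun ω ↦ Y t ω ^ j) P
  moment_deriv : ∀ t, 0 ≤ t → HasDerivWithinAt (moment_at P Y k)
    (-(k : ℝ) * moment_at P Y (k + 2) t + (k : ℝ) * moment_at P Y k t
      + σ ^ 2 / 2 * (k : ℝ) * ((k : ℝ) - 1) * moment_at P Y (k - 2) t
      - (k : ℝ) * ν t * moment_at P Y (k - 1) t) (Ici 0) t
  ν_deriv : ∀ t, 0 ≤ t → HasDerivWithinAt ν
    (-(α - θ) * ν t - θ * (-moment_at P Y 3 t + moment_at P Y 1 t)) (Ici 0) t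
  ν_deriv_mean : ∀ t, 0 ≤ t → HasDerivWithinAt ν
    (-α * ν t - θ * derivWithin (moment_at P Y 1) (Ici 0) t) (Ici 0) t

end

/-! Write `a = 1 - 3m² - 3σ²V`. The equation for `V` is `V' = 1 + 2aV`, so `V` is the variance of
the solution `z` of `dz = a z dt + dB`, and `y = m + σz` is Gaussian with mean `m` and variance
`σ²V`. For a Gaussian the moments of order 3 and 4 are polynomials in the mean and variance.
Inserting them into the moment equations for `k = 1, 2` gives exactly the equations for `m` and `V`.

Global existence: in the coordinates `(m, ν + θm, V)` the field is polynomial, and a priori bounds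
hold even for a truncated field (`aux_bounds`), so truncated solutions solve the original system.
The same bounds, with one on `σV`, are uniform in `σ`.

Since the integrand `ψ = exp(-∫a)` is deterministic and `C¹`, the Wiener integral `∫ψ dB` is defined
pathwise by integration by parts. It is an almost sure limit of Riemann sums, hence Gaussian with
variance `∫ψ²`, and `z` is `ψ⁻¹` times it by variation of constants. The covariance of `y` at times
`r ≤ t` factors into a function of `r` and a function of `t`, so a multiple of `y s` can be
subtracted from `y t` to leave a variable independent of the past of `s`. This is the Markov
property (`isMarkovReal_of_covariance`).

For the error, the noise cancels in `D = x - y`, and `D' = -(x³ - y³) + D - r` with `r = (μ - ν) +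
closureError`. The closure error `3mσ²(z² - V) + σ³(z³ - 3Vz)` consists of Hermite polynomials in
`z` and has first absolute moment `O(σ²)`. The cubic term is monotone, so `|D(t)| ≤ exp(t) ∫|r|`
pathwise. Moreover `μ' = -αμ - θ (E x)'` and `ν' = -αν - θ (E y)'`, so `μ - ν = -α∫(μ - ν) - θ E[x -
y]`. No cubic moment remains there, and Gronwall gives `|μ - ν| = O(σ²)`, then the bound for `D`.
The exchange of expectation and time integral needs joint integrability of `x³ - y³`, which comes
from the energy `√(1 + D²)` (`integral_abs_cube_sub_cube_le`). -/

/-! ### Comparison lemmas and global solutions of ODEs -/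

/-- Fencing on `[0, T]`: `f` cannot cross `B` if `f' < B'` wherever `f = B`. -/
lemma le_of_deriv_lt_of_eq {f f' B B' : ℝ → ℝ} {T : ℝ}
    (hf : ∀ t ∈ Icc 0 T, HasDerivWithinAt f (f' t) (Icc 0 T) t) (h0 : f 0 ≤ B 0)
    (hB : ∀ t ∈ Icc 0 T, HasDerivWithinAt B (B' t) (Icc 0 T) t)
    (bound : ∀ t ∈ Icc 0 T, f t = B t → f' t < B' t) : ∀ t ∈ Icc 0 T, f t ≤ B t := by
  intro t ht
  refine image_le_of_deriv_right_lt_deriv_boundary' (f' := f') (B' := B')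
    (fun t ht ↦ (hf t ht).continuousWithinAt) ?_ h0
    (fun t ht ↦ (hB t ht).continuousWithinAt) ?_ ?_ ht
  · exact fun t ht ↦ (hf t (Ico_subset_Icc_self ht)).mono_of_mem_nhdsWithin
      (Icc_mem_nhdsGE_of_mem ht)
  · exact fun t ht ↦ (hB t (Ico_subset_Icc_self ht)).mono_of_mem_nhdsWithin
      (Icc_mem_nhdsGE_of_mem ht)
  · exact fun t ht ↦ bound t (Ico_subset_Icc_self ht)

lemma hasDerivWithinAt_integral_Icc {g : ℝ → ℝ} {T t : ℝ} (hg : ContinuousOn g (Icc 0 T))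
    (ht : t ∈ Icc 0 T) :
    HasDerivWithinAt (fun t ↦ ∫ s in (0 : ℝ)..t, g s) (g t) (Icc 0 T) t := by
  have : Fact (t ∈ Icc 0 T) := ⟨ht⟩
  refine intervalIntegral.integral_hasDerivWithinAt_right (s := Icc 0 T) (t := Icc 0 T) ?_ ?_
    (hg t ht)
  · exact (hg.mono (by rw [uIcc_of_le ht.1]; exact Icc_subset_Icc_right ht.2)).intervalIntegrable
  · exact hg.stronglyMeasurableAtFilter_nhdsWithin measurableSet_Icc t

/-- Gronwall's inequality in one-sided form: if `f' ≤ c f + h` wherever `f > 0`, then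
`f(t) ≤ exp(ct) ∫₀ᵗ h`. -/
lemma le_exp_mul_integral {f f' h : ℝ → ℝ} {T c : ℝ} (hc : 0 ≤ c)
    (hf : ∀ t ∈ Icc 0 T, HasDerivWithinAt f (f' t) (Icc 0 T) t) (h0 : f 0 ≤ 0)
    (hh : ContinuousOn h (Icc 0 T)) (hh0 : ∀ t ∈ Icc 0 T, 0 ≤ h t)
    (bound : ∀ t ∈ Icc 0 T, 0 < f t → f' t ≤ c * f t + h t) :
    ∀ t ∈ Icc 0 T, f t ≤ Real.exp (c * t) * ∫ s in (0 : ℝ)..t, h s := by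
  intro t ht
  have hH := fun t ht ↦ hasDerivWithinAt_integral_Icc (t := t) hh ht
  have hpos : ∀ t ∈ Icc 0 T, 0 ≤ ∫ s in (0 : ℝ)..t, h s := fun t ht ↦
    intervalIntegral.integral_nonneg ht.1 fun s hs ↦ hh0 s ⟨hs.1, hs.2.trans ht.2⟩
  -- The term `ε (1 + t)` keeps the barrier positive, so that `bound` applies at a contact point,
  -- and makes its slope strictly larger there. Afterwards `ε → 0`.
  have key : ∀ ε > 0, f t ≤ Real.exp (c * t) * ((∫ s in (0 : ℝ)..t, h s) + ε * (1 + t)) := by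
    intro ε hε
    refine le_of_deriv_lt_of_eq (T := T) (f' := f')
      (B := fun t ↦ Real.exp (c * t) * ((∫ s in (0 : ℝ)..t, h s) + ε * (1 + t)))
      (B' := fun t ↦ Real.exp (c * t) * (c * 1) * ((∫ s in (0 : ℝ)..t, h s) + ε * (1 + t)) +
        Real.exp (c * t) * (h t + ε * 1)) hf ?_ ?_ ?_ t ht
    · simp only [intervalIntegral.integral_same]; simp; linarith
    · intro t ht
      refine HasDerivWithinAt.mul ?_ ((hH t ht).add ?_)
      · exact (((hasDerivAt_id t).const_mul c).exp).hasDerivWithinAt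
      · exact (((hasDerivAt_id t).const_add 1).const_mul ε).hasDerivWithinAt
    · intro t ht hft
      have h1 : 0 < Real.exp (c * t) * ((∫ s in (0 : ℝ)..t, h s) + ε * (1 + t)) := by
        have := hpos t ht
        have h2 : 0 < 1 + t := by linarith [ht.1]
        positivity
      have h2 := bound t ht (hft ▸ h1)
      have h3 : 1 ≤ Real.exp (c * t) := Real.one_le_exp (mul_nonneg hc ht.1)
      have h4 : h t + ε * 1 ≤ Real.exp (c * t) * (h t + ε * 1) :=
        le_mul_of_one_le_left (by linarith [hh0 t ht]) h3
      rw [hft] at h2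
      linarith
  have hlim : Filter.Tendsto (fun ε : ℝ ↦
      Real.exp (c * t) * ((∫ s in (0 : ℝ)..t, h s) + ε * (1 + t))) (nhdsWithin 0 (Ioi 0))
      (nhds (Real.exp (c * t) * ((∫ s in (0 : ℝ)..t, h s) + 0 * (1 + t)))) :=
    Filter.Tendsto.mono_left (Continuous.tendsto (by fun_prop) 0) nhdsWithin_le_nhds
  simpa using ge_of_tendsto hlim (Filter.eventually_of_mem self_mem_nhdsWithin key)

section ODE

variable {E : Type*} [NormedAddCommGroup E] [NormedSpace ℝ E]

/-- A bounded, globally Lipschitz vector field has solutions on every `[0, T]`. -/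
lemma exists_solution_of_bounded_lipschitz [CompleteSpace E] {G : E → E} {K L : ℝ≥0}
    (hG : LipschitzWith K G) (hL : ∀ u, ‖G u‖ ≤ L) (u₀ : E) {T : ℝ} (hT : 0 ≤ T) :
    ∃ u : ℝ → E, u 0 = u₀ ∧
      ∀ t ∈ Icc 0 T, HasDerivWithinAt u (G (u t)) (Icc 0 T) t := by
  -- A speed at most `L` covers at most the distance `L * T`, so with this radius a single
  -- application reaches time `T`.
  have hp : IsPicardLindelof (fun _ ↦ G) (⟨0, le_rfl, hT⟩ : Icc 0 T) u₀
      (L * T.toNNReal) 0 L K :=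
    .of_time_independent (fun u _ ↦ hL u) hG.lipschitzOnWith (by simp [hT])
  exact hp.exists_eq_forall_mem_Icc_hasDerivWithinAt₀

/-- Both trajectories are compact, hence lie in one closed ball, on which a `C¹` field is Lipschitz.
-/
lemma solution_unique_of_contDiff [ProperSpace E] {F : E → E} (hF : ContDiff ℝ 1 F)
    {u w : ℝ → E} {T : ℝ} (hu : ∀ t ∈ Icc 0 T, HasDerivWithinAt u (F (u t)) (Icc 0 T) t)
    (hw : ∀ t ∈ Icc 0 T, HasDerivWithinAt w (F (w t)) (Icc 0 T) t) (h0 : u 0 = w 0) :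
    EqOn u w (Icc 0 T) := by
  have hcu : ContinuousOn u (Icc 0 T) := fun t ht ↦ (hu t ht).continuousWithinAt
  have hcw : ContinuousOn w (Icc 0 T) := fun t ht ↦ (hw t ht).continuousWithinAt
  obtain ⟨R, hR⟩ := ((isCompact_Icc.image_of_continuousOn hcu).union
    (isCompact_Icc.image_of_continuousOn hcw)).isBounded.subset_closedBall 0
  obtain ⟨K, hK⟩ := hF.contDiffOn.exists_lipschitzOnWith one_ne_zero
    (convex_closedBall (0 : E) R) (isCompact_closedBall _ _)
  refine ODE_solution_unique_of_mem_Icc_right (v := fun _ ↦ F) (K := K)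
    (s := fun _ ↦ Metric.closedBall 0 R) (fun _ _ ↦ hK) hcu ?_ ?_ hcw ?_ ?_ h0
  · exact fun t ht ↦ (hu t (Ico_subset_Icc_self ht)).mono_of_mem_nhdsWithin
      (Icc_mem_nhdsGE_of_mem ht)
  · exact fun t ht ↦ hR (.inl (mem_image_of_mem u (Ico_subset_Icc_self ht)))
  · exact fun t ht ↦ (hw t (Ico_subset_Icc_self ht)).mono_of_mem_nhdsWithin
      (Icc_mem_nhdsGE_of_mem ht)
  · exact fun t ht ↦ hR (.inr (mem_image_of_mem w (Ico_subset_Icc_self ht)))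

/-- Solutions on all `[0, n]` of an autonomous `C¹` equation can be patched together. -/
lemma exists_global_solution [ProperSpace E] {F : E → E} (hF : ContDiff ℝ 1 F) {u₀ : E}
    (h : ∀ n : ℕ, ∃ u : ℝ → E, u 0 = u₀ ∧
      ∀ t ∈ Icc (0 : ℝ) n, HasDerivWithinAt u (F (u t)) (Icc 0 n) t) :
    ∃ u : ℝ → E, u 0 = u₀ ∧ ∀ t, 0 ≤ t → HasDerivWithinAt u (F (u t)) (Ici 0) t := by
  choose u hu0 hu using h
  have huniq : ∀ {n k : ℕ}, n ≤ k → EqOn (u n) (u k) (Icc 0 n) := by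
    intro n k hnk
    have hsub : Icc (0 : ℝ) n ⊆ Icc 0 k := Icc_subset_Icc_right (by exact_mod_cast hnk)
    exact solution_unique_of_contDiff hF (hu n)
      (fun t ht ↦ (hu k t (hsub ht)).mono hsub) (by rw [hu0, hu0])
  have hv : ∀ (n : ℕ), ∀ t ∈ Icc (0 : ℝ) n, u ⌈t⌉₊ t = u n t := fun n t ht ↦
    huniq (Nat.ceil_le.2 ht.2) ⟨ht.1, Nat.le_ceil t⟩
  refine ⟨fun t ↦ u ⌈t⌉₊ t, by simp [hu0], fun t ht ↦ ?_⟩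
  -- The inequality `t < n` is strict so that `[0, n]` is a neighbourhood of `t` within `[0, ∞)`.
  obtain ⟨n, hn⟩ := exists_nat_gt t
  have hmem : Icc (0 : ℝ) n ∈ nhdsWithin t (Ici 0) := by
    rw [← Ici_inter_Iic, inter_comm]
    exact Filter.inter_mem (mem_nhdsWithin_of_mem_nhds (Iic_mem_nhds hn)) self_mem_nhdsWithin
  have h1 := (hu n t ⟨ht, hn.le⟩).congr (hv n) (hv n t ⟨ht, hn.le⟩)
  rw [← hv n t ⟨ht, hn.le⟩] at h1
  exact h1.mono_of_mem_nhdsWithin hmem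

end ODE

/-! ### The auxiliary system -/

lemma hasDerivWithinAt_coords {u : ℝ → ℝ × ℝ × ℝ} {u' : ℝ × ℝ × ℝ} {s : Set ℝ} {t : ℝ}
    (h : HasDerivWithinAt u u' s t) :
    HasDerivWithinAt (fun t ↦ (u t).1) u'.1 s t ∧
      HasDerivWithinAt (fun t ↦ (u t).2.1) u'.2.1 s t ∧
        HasDerivWithinAt (fun t ↦ (u t).2.2) u'.2.2 s t := by
  rw [hasDerivWithinAt_iff_hasFDerivWithinAt] at h
  refine ⟨?_, ?_, ?_⟩
  · simpa using h.fst.hasDerivWithinAt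
  · simpa using h.snd.fst.hasDerivWithinAt
  · simpa using h.snd.snd.hasDerivWithinAt

/-- The vector field of the auxiliary system in the coordinates `(m, p, V)`, `p = ν + θ m`. -/
def auxField (α θ σ : ℝ) (u : ℝ × ℝ × ℝ) : ℝ × ℝ × ℝ :=
  (-u.1 ^ 3 + (1 + θ) * u.1 - u.2.1 - 3 * σ ^ 2 * u.1 * u.2.2,
    -α * (u.2.1 - θ * u.1),
    1 + 2 * (1 - 3 * u.1 ^ 2) * u.2.2 - 6 * σ ^ 2 * u.2.2 ^ 2)

lemma contDiff_auxField (α θ σ : ℝ) : ContDiff ℝ 1 (auxField α θ σ) := by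
  unfold auxField
  fun_prop

/-- An a priori bound for `m² + p²`. -/
noncomputable def auxBound (α θ x₀ μ₀ t : ℝ) : ℝ :=
  (x₀ ^ 2 + (μ₀ + θ * x₀) ^ 2 + 1) * Real.exp ((2 * (1 + θ) + (1 + α * θ) + 1) * t)

lemma auxBound_pos (α θ x₀ μ₀ t : ℝ) : 0 < auxBound α θ x₀ μ₀ t := by
  unfold auxBound; positivity

lemma auxBound_mono {α θ : ℝ} (hα : 0 ≤ α) (hθ : 0 ≤ θ) (x₀ μ₀ : ℝ) {s t : ℝ} (hst : s ≤ t) :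
    auxBound α θ x₀ μ₀ s ≤ auxBound α θ x₀ μ₀ t := by
  unfold auxBound; gcongr

/-- A priori bounds for the auxiliary system on `[0, T]`, also after truncation of the coordinates
by a function `c` which is the identity on a large interval. -/
lemma aux_bounds {α θ σ x₀ μ₀ T R : ℝ} (hα : 0 ≤ α) (hθ : 0 ≤ θ) (hσ : 0 < σ) {c : ℝ → ℝ}
    (hc : ∀ u, |u| ≤ R → c u = u) (hR1 : Real.exp (3 * T) ≤ R)
    (hR2 : auxBound α θ x₀ μ₀ T ≤ R) {u : ℝ → ℝ × ℝ × ℝ}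
    (h0 : u 0 = (x₀, μ₀ + θ * x₀, 0))
    (hu : ∀ t ∈ Icc 0 T, HasDerivWithinAt u
      (auxField α θ σ (c (u t).1, c (u t).2.1, c (u t).2.2)) (Icc 0 T) t) :
    ∀ t ∈ Icc 0 T, 0 ≤ (u t).2.2 ∧ (u t).2.2 ≤ Real.exp (3 * t) ∧
      (u t).1 ^ 2 + (u t).2.1 ^ 2 ≤ auxBound α θ x₀ μ₀ t := by
  have hm := fun t ht ↦ (hasDerivWithinAt_coords (hu t ht)).1
  have hp := fun t ht ↦ (hasDerivWithinAt_coords (hu t ht)).2.1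
  have hV := fun t ht ↦ (hasDerivWithinAt_coords (hu t ht)).2.2
  have hexp : ∀ t ∈ Icc 0 T, 1 ≤ Real.exp (3 * t) ∧ Real.exp (3 * t) ≤ R := fun t ht ↦
    ⟨Real.one_le_exp (by linarith [ht.1]),
      (Real.exp_le_exp.2 (by linarith [ht.2])).trans hR1⟩
  have hV0 : ∀ t ∈ Icc 0 T, 0 ≤ (u t).2.2 := by
    have := le_of_deriv_lt_of_eq (f := fun t ↦ -(u t).2.2)
      (fun t ht ↦ (hV t ht).fun_neg) (B := fun _ ↦ 0) (B' := fun _ ↦ 0)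
      (by simp [h0]) (fun t _ ↦ hasDerivWithinAt_const _ _ _) ?_
    · exact fun t ht ↦ by simpa using this t ht
    · intro t ht h
      have hz : (u t).2.2 = 0 := by simpa using h
      have := hexp t ht
      simp [auxField, hz, hc 0 (by simp; linarith)]
  have hV1 : ∀ t ∈ Icc 0 T, (u t).2.2 ≤ Real.exp (3 * t) := by
    refine le_of_deriv_lt_of_eq hV (B := fun t ↦ Real.exp (3 * t))
      (B' := fun t ↦ Real.exp (3 * t) * (3 * 1)) (by simp [h0])
      (fun t _ ↦ (((hasDerivAt_id t).const_mul 3).exp).hasDerivWithinAt) ?_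
    -- At contact `V ≥ 1`, so `1 + 2V ≤ 3V`, and the term `-6σ²V²` makes the inequality strict.
    intro t ht h
    obtain ⟨h1, h2⟩ := hexp t ht
    rw [← h] at h1 h2 ⊢
    simp only [auxField]
    rw [hc (u t).2.2 (by rw [abs_le]; constructor <;> linarith)]
    have : 0 ≤ c (u t).1 ^ 2 * (u t).2.2 := by positivity
    have : 0 < σ ^ 2 * (u t).2.2 ^ 2 := by positivity
    linarith
  have hN : ∀ t ∈ Icc 0 T, (u t).1 ^ 2 + (u t).2.1 ^ 2 ≤ auxBound α θ x₀ μ₀ t := by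
    refine le_of_deriv_lt_of_eq (fun t ht ↦ ((hm t ht).fun_pow 2).fun_add ((hp t ht).fun_pow 2))
      (B' := fun t ↦ (x₀ ^ 2 + (μ₀ + θ * x₀) ^ 2 + 1) *
        (Real.exp ((2 * (1 + θ) + (1 + α * θ) + 1) * t) * ((2 * (1 + θ) + (1 + α * θ) + 1) * 1)))
      (by simp [h0, auxBound])
      (fun t _ ↦ (((((hasDerivAt_id t).const_mul _).exp).const_mul _)).hasDerivWithinAt) ?_
    intro t ht h
    have h : (u t).1 ^ 2 + (u t).2.1 ^ 2 = auxBound α θ x₀ μ₀ t := h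
    have hpos := auxBound_pos α θ x₀ μ₀ t
    have hle : auxBound α θ x₀ μ₀ t ≤ R := (auxBound_mono hα hθ x₀ μ₀ ht.2).trans hR2
    obtain ⟨h1, h2⟩ := hexp t ht
    -- As `R ≥ 1`, a bound by `R` on the square is also a bound by `R` on the coordinate itself.
    have hRR : R ≤ R ^ 2 := by nlinarith
    have c1 : c (u t).1 = (u t).1 := hc _ (abs_le_of_sq_le_sq (by nlinarith) (by linarith))
    have c2 : c (u t).2.1 = (u t).2.1 := hc _ (abs_le_of_sq_le_sq (by nlinarith) (by linarith))
    have c3 : c (u t).2.2 = (u t).2.2 := hc _ (by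
      rw [abs_le]; constructor <;> linarith [hV0 t ht, hV1 t ht])
    have hR' : (x₀ ^ 2 + (μ₀ + θ * x₀) ^ 2 + 1) *
        (Real.exp ((2 * (1 + θ) + (1 + α * θ) + 1) * t) * ((2 * (1 + θ) + (1 + α * θ) + 1) * 1))
        = (2 * (1 + θ) + (1 + α * θ) + 1) * ((u t).1 ^ 2 + (u t).2.1 ^ 2) := by
      rw [h, auxBound]; ring
    rw [hR']
    simp only [auxField, c1, c2, c3]
    have hVt := hV0 t ht
    generalize (u t).1 = m at *
    generalize (u t).2.1 = p at *
    generalize (u t).2.2 = V at *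
    -- The derivative of `m² + p²` is `-2m⁴ - 6σ²m²V - 2αp² + 2(1 + θ)m² + 2(αθ - 1)mp`, and the
    -- mixed term is at most `(1 + αθ)(m² + p²)`. The last `+ 1` in the rate of `auxBound` gives
    -- strictness, since `m² + p²` is positive at contact.
    have e1 : 0 ≤ (1 + α * θ) * (m + p) ^ 2 := by positivity
    have e1' : 0 ≤ (1 + α * θ) * (m - p) ^ 2 := by positivity
    have e2 : 0 ≤ m ^ 4 := by positivity
    have e3 : 0 ≤ σ ^ 2 * V * m ^ 2 := by positivity
    have e4 : 0 ≤ α * p ^ 2 := by positivity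
    have e5 : 0 ≤ θ * p ^ 2 := by positivity
    have e6 : 0 ≤ α * θ * (m - p) ^ 2 := by positivity
    have e7 : 0 ≤ α * θ * (m ^ 2 + p ^ 2) := by positivity
    norm_num
    nlinarith [sq_nonneg (m + p), sq_nonneg (m - p)]
  exact fun t ht ↦ ⟨hV0 t ht, hV1 t ht, hN t ht⟩

/-- Clipping the coordinates to `[-R, R]` makes the field bounded and globally Lipschitz. With `R`
above the a priori bounds, the solution of the clipped system stays where clipping does nothing. -/
lemma exists_auxField_solution {α θ σ : ℝ} (hα : 0 ≤ α) (hθ : 0 ≤ θ) (hσ : 0 < σ) (x₀ μ₀ : ℝ)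
    {T : ℝ} (hT : 0 ≤ T) :
    ∃ u : ℝ → ℝ × ℝ × ℝ, u 0 = (x₀, μ₀ + θ * x₀, 0) ∧
      ∀ t ∈ Icc 0 T, HasDerivWithinAt u (auxField α θ σ (u t)) (Icc 0 T) t := by
  set R : ℝ := Real.exp (3 * T) + auxBound α θ x₀ μ₀ T with hRdef
  have hb := auxBound_pos α θ x₀ μ₀ T
  have he := Real.exp_pos (3 * T)
  have hR0 : 0 ≤ R := by positivity
  set c : ℝ → ℝ := fun u ↦ max (-R) (min R u) with hcdef
  have hcl : LipschitzWith 1 c := (LipschitzWith.id.const_min R).const_max (-R)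
  have hcR : ∀ u, |c u| ≤ R := fun u ↦ abs_le.2
    ⟨le_max_left _ _, max_le (by linarith) (min_le_left _ _)⟩
  have hc : ∀ u, |u| ≤ R → c u = u := fun u hu ↦ by
    rw [abs_le] at hu
    simp only [hcdef]
    rw [min_eq_right hu.2, max_eq_right hu.1]
  let C : ℝ × ℝ × ℝ → ℝ × ℝ × ℝ := fun u ↦ (c u.1, c u.2.1, c u.2.2)
  have hCl : LipschitzWith 1 C := by
    have h1 : LipschitzWith (1 * 1) fun u : ℝ × ℝ × ℝ ↦ c u.1 :=
      hcl.comp LipschitzWith.prod_fst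
    have h2 : LipschitzWith (1 * (1 * 1)) fun u : ℝ × ℝ × ℝ ↦ c u.2.1 :=
      hcl.comp (LipschitzWith.prod_fst.comp LipschitzWith.prod_snd)
    have h3 : LipschitzWith (1 * (1 * 1)) fun u : ℝ × ℝ × ℝ ↦ c u.2.2 :=
      hcl.comp (LipschitzWith.prod_snd.comp LipschitzWith.prod_snd)
    simpa using h1.prodMk (h2.prodMk h3)
  have hCR : ∀ u, C u ∈ Metric.closedBall (0 : ℝ × ℝ × ℝ) R := fun u ↦ by
    simp only [mem_closedBall_zero_iff, C, Prod.norm_def, Real.norm_eq_abs]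
    exact max_le (hcR _) (max_le (hcR _) (hcR _))
  obtain ⟨K, hK⟩ := (contDiff_auxField α θ σ).contDiffOn.exists_lipschitzOnWith one_ne_zero
    (convex_closedBall (0 : ℝ × ℝ × ℝ) R) (isCompact_closedBall _ _)
  obtain ⟨L, hL⟩ := (isCompact_closedBall (0 : ℝ × ℝ × ℝ) R).exists_bound_of_continuousOn
    (contDiff_auxField α θ σ).continuous.continuousOn
  have hG : LipschitzWith (K * 1) (auxField α θ σ ∘ C) := by
    rw [← lipschitzOnWith_univ] at hCl ⊢
    exact hK.comp hCl fun u _ ↦ hCR u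
  obtain ⟨u, hu0, hu⟩ := exists_solution_of_bounded_lipschitz (L := L.toNNReal) hG
    (fun u ↦ (hL _ (hCR u)).trans (Real.le_coe_toNNReal L)) (x₀, μ₀ + θ * x₀, (0 : ℝ)) hT
  refine ⟨u, hu0, fun t ht ↦ ?_⟩
  have hbd := aux_bounds hα hθ hσ hc (by linarith) (by linarith) hu0 hu
  obtain ⟨h1, h2, h3⟩ := hbd t ht
  have h4 := auxBound_mono hα hθ x₀ μ₀ ht.2
  have h5 : Real.exp (3 * t) ≤ Real.exp (3 * T) := Real.exp_le_exp.2 (by linarith [ht.2])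
  have h6 : 1 ≤ Real.exp (3 * T) := Real.one_le_exp (by linarith)
  have hRR : R ≤ R ^ 2 := by nlinarith
  have hCu : C (u t) = u t := by
    refine Prod.ext ?_ (Prod.ext ?_ ?_)
    · exact hc _ (abs_le_of_sq_le_sq (by nlinarith) hR0)
    · exact hc _ (abs_le_of_sq_le_sq (by nlinarith) hR0)
    · exact hc _ (abs_le.2 ⟨by linarith, by linarith⟩)
  have := hu t ht
  rwa [Function.comp_apply, hCu] at this

/-- The auxiliary system has a global solution. -/
lemma exists_isAuxSolution {α θ σ : ℝ} (hα : 0 ≤ α) (hθ : 0 ≤ θ) (hσ : 0 < σ) (x₀ μ₀ : ℝ) :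
    ∃ m ν V : ℝ → ℝ, IsAuxSolution α θ σ x₀ μ₀ m ν V := by
  obtain ⟨u, hu0, hu⟩ := exists_global_solution (contDiff_auxField α θ σ)
    fun n ↦ exists_auxField_solution hα hθ hσ x₀ μ₀ (Nat.cast_nonneg n)
  have hm := fun t ht ↦ (hasDerivWithinAt_coords (hu t ht)).1
  have hp := fun t ht ↦ (hasDerivWithinAt_coords (hu t ht)).2.1
  have hV := fun t ht ↦ (hasDerivWithinAt_coords (hu t ht)).2.2
  have hm' : ∀ t, 0 ≤ t → HasDerivWithinAt (fun t ↦ (u t).1)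
      (auxMeanDrift σ (u t).1 ((u t).2.1 - θ * (u t).1) (u t).2.2) (Ici 0) t := fun t ht ↦ by
    refine (hm t ht).congr_deriv ?_
    simp only [auxMeanDrift, auxField]; ring
  refine ⟨fun t ↦ (u t).1, fun t ↦ (u t).2.1 - θ * (u t).1, fun t ↦ (u t).2.2,
    by simp [hu0], by simp [hu0], by simp [hu0], hm', fun t ht ↦ ?_, hV⟩
  exact (hp t ht).fun_sub ((hm' t ht).const_mul θ)

namespace IsAuxSolution

variable {α θ σ x₀ μ₀ : ℝ} {m ν V : ℝ → ℝ}

lemma continuousOn_m (h : IsAuxSolution α θ σ x₀ μ₀ m ν V) : ContinuousOn m (Ici 0) :=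
  fun t ht ↦ (h.m_deriv t ht).continuousWithinAt

lemma continuousOn_ν (h : IsAuxSolution α θ σ x₀ μ₀ m ν V) : ContinuousOn ν (Ici 0) :=
  fun t ht ↦ (h.ν_deriv t ht).continuousWithinAt

lemma continuousOn_V (h : IsAuxSolution α θ σ x₀ μ₀ m ν V) : ContinuousOn V (Ici 0) :=
  fun t ht ↦ (h.V_deriv t ht).continuousWithinAt

/-- Bounds for the auxiliary system which are uniform in `σ`. -/
lemma bounds (h : IsAuxSolution α θ σ x₀ μ₀ m ν V) (hα : 0 ≤ α) (hθ : 0 ≤ θ) (hσ : 0 < σ)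
    {t : ℝ} (ht : 0 ≤ t) :
    0 ≤ V t ∧ V t ≤ Real.exp (3 * t) ∧ σ * V t ≤ Real.exp (3 * t) ∧
      m t ^ 2 ≤ auxBound α θ x₀ μ₀ t := by
  have hu : ∀ s ∈ Icc 0 t, HasDerivWithinAt (fun s ↦ (m s, ν s + θ * m s, V s))
      (auxField α θ σ (m s, ν s + θ * m s, V s)) (Icc 0 t) s := by
    intro s hs
    have h1 := (h.m_deriv s hs.1)
    have h2 := h1.prodMk (((h.ν_deriv s hs.1).add (h1.const_mul θ)).prodMk (h.V_deriv s hs.1))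
    refine (HasDerivWithinAt.congr_deriv h2 ?_).mono Icc_subset_Ici_self
    simp only [auxField, auxMeanDrift, Prod.mk.injEq, and_true]
    constructor <;> ring
  have hb := aux_bounds (R := Real.exp (3 * t) + auxBound α θ x₀ μ₀ t) hα hθ hσ (c := id)
    (fun _ _ ↦ rfl) (by linarith [auxBound_pos α θ x₀ μ₀ t]) (by linarith [Real.exp_pos (3 * t)])
    (by simp [h.m_zero, h.ν_zero, h.V_zero]) hu
  obtain ⟨h1, h2, h3⟩ := hb t ⟨ht, le_rfl⟩
  refine ⟨h1, h2, ?_, by simp only at h3; nlinarith [sq_nonneg (ν t + θ * m t)]⟩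
  refine le_of_deriv_lt_of_eq (T := t)
    (fun s hs ↦ ((h.V_deriv s hs.1).mono Icc_subset_Ici_self).const_mul σ)
    (B := fun t ↦ Real.exp (3 * t)) (B' := fun t ↦ Real.exp (3 * t) * (3 * 1)) (by simp [h.V_zero])
    (fun t _ ↦ (((hasDerivAt_id t).const_mul 3).exp).hasDerivWithinAt) ?_ t ⟨ht, le_rfl⟩
  intro s hs hst
  -- The source term of `(σV)'` is `σ`, which is not bounded in `σ`. At contact `σV ≥ 1`, so the
  -- damping `-6σ(σV)²` absorbs it.
  have h5 : 1 ≤ σ * V s := hst ▸ Real.one_le_exp (by linarith [hs.1])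
  rw [← hst]
  have h6 : 0 ≤ m s ^ 2 * (σ * V s) := by positivity
  have h7 : σ * 1 ≤ σ * (σ * V s) ^ 2 := by gcongr; nlinarith
  nlinarith

end IsAuxSolution

/-! ### Limits of Gaussian variables and processes -/

section GaussianLimit

variable {Ω : Type*} [MeasurableSpace Ω] {P : Measure Ω}

/-- An almost sure limit of centered real Gaussian variables is a centered Gaussian variable, and
the variances converge. -/
lemma exists_gaussianReal_limit [IsProbabilityMeasure P] {X : ℕ → Ω → ℝ} {Y : Ω → ℝ} {v : ℕ → ℝ≥0}
    (hX : ∀ n, HasLaw (X n) (gaussianReal 0 (v n)) P)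
    (hlim : ∀ᵐ ω ∂P, Filter.Tendsto (X · ω) Filter.atTop (nhds (Y ω))) :
    ∃ w : ℝ≥0, HasLaw Y (gaussianReal 0 w) P ∧ Filter.Tendsto v Filter.atTop (nhds w) := by
  have hYm : AEMeasurable Y P :=
    aemeasurable_of_tendsto_metrizable_ae' (fun n ↦ (hX n).aemeasurable) hlim
  have hPY : IsProbabilityMeasure (P.map Y) := Measure.isProbabilityMeasure_map hYm
  have hφn : ∀ n ξ, charFun (P.map (X n)) ξ = (Real.exp (-(v n * ξ ^ 2 / 2)) : ℂ) := fun n ξ ↦ by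
    rw [(hX n).map_eq, charFun_gaussianReal]; push_cast; congr 1; ring
  have hφ : ∀ ξ, Filter.Tendsto (fun n ↦ charFun (P.map (X n)) ξ) Filter.atTop
      (nhds (charFun (P.map Y) ξ)) := by
    intro ξ
    simp only [charFun_apply_real]
    rw [integral_map hYm (by fun_prop)]
    simp_rw [fun n ↦ integral_map (μ := P) (hX n).aemeasurable (f := fun x : ℝ ↦
      Complex.exp (ξ * x * Complex.I)) (by fun_prop)]
    refine tendsto_integral_of_dominated_convergence (fun _ ↦ 1) ?_ (integrable_const _) ?_ ?_
    · intro n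
      have := (hX n).aemeasurable
      exact AEMeasurable.aestronglyMeasurable (by fun_prop)
    · intro n
      refine Filter.Eventually.of_forall fun ω ↦ ?_
      rw [← Complex.ofReal_mul, Complex.norm_exp_ofReal_mul_I]
    · filter_upwards [hlim] with ω hω
      exact ((Complex.continuous_ofReal.tendsto _).comp hω |>.const_mul _ |>.mul_const _).cexp
  have hcont : Continuous (charFun (P.map Y)) := continuous_charFun
  -- The variance is recovered as `-2 log|φ(ξ)| / ξ²`, which needs one frequency `ξ ≠ 0` where the
  -- limit `φ` does not vanish. One exists near `0`, because `φ(0) = 1` and `φ` is continuous.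
  obtain ⟨ξ, hξ0, hξ⟩ : ∃ ξ : ℝ, ξ ≠ 0 ∧ 0 < ‖charFun (P.map Y) ξ‖ := by
    have h1 : ∀ᶠ ξ in nhdsWithin (0 : ℝ) {0}ᶜ, 0 < ‖charFun (P.map Y) ξ‖ :=
      (hcont.norm.continuousAt.eventually (lt_mem_nhds (by simp))).filter_mono
        nhdsWithin_le_nhds
    obtain ⟨ξ, h2, h3⟩ := (h1.and self_mem_nhdsWithin).exists
    exact ⟨ξ, h3, h2⟩
  have hv : Filter.Tendsto (fun n ↦ (v n : ℝ)) Filter.atTop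
      (nhds (-2 * Real.log ‖charFun (P.map Y) ξ‖ / ξ ^ 2)) := by
    have h1 := (((hφ ξ).norm.log hξ.ne').const_mul (-2)).div_const (ξ ^ 2)
    refine h1.congr fun n ↦ ?_
    rw [hφn, Complex.norm_real, Real.norm_eq_abs, Real.abs_exp, Real.log_exp]
    field_simp
  have hw : 0 ≤ -2 * Real.log ‖charFun (P.map Y) ξ‖ / ξ ^ 2 :=
    ge_of_tendsto' hv fun n ↦ (v n).2
  obtain ⟨w, hw⟩ : ∃ w : ℝ≥0, (w : ℝ) = -2 * Real.log ‖charFun (P.map Y) ξ‖ / ξ ^ 2 :=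
    ⟨⟨_, hw⟩, rfl⟩
  rw [← hw] at hv
  refine ⟨w, ⟨hYm, ?_⟩, NNReal.tendsto_coe.1 hv⟩
  refine Measure.ext_of_charFun (funext fun ζ ↦ tendsto_nhds_unique (hφ ζ) ?_)
  rw [charFun_gaussianReal]
  simp_rw [hφn]
  have h2 : Filter.Tendsto (fun n ↦ Real.exp (-(v n * ζ ^ 2 / 2))) Filter.atTop
      (nhds (Real.exp (-(w * ζ ^ 2 / 2)))) := ((hv.mul_const _).div_const _).neg.rexp
  have h3 := (Complex.continuous_ofReal.tendsto _).comp h2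
  rw [show Complex.exp (ζ * ((0 : ℝ) : ℂ) * Complex.I - ((w : ℝ) : ℂ) * ζ ^ 2 / 2) =
    (Real.exp (-(w * ζ ^ 2 / 2)) : ℂ) by
      rw [Complex.ofReal_exp]; congr 1; push_cast; ring]
  exact h3

lemma hasLaw_gaussianReal_of_integral_eq_zero {X : Ω → ℝ} (hX : HasGaussianLaw X P)
    (h0 : ∫ ω, X ω ∂P = 0) : HasLaw X (gaussianReal 0 Var[X; P].toNNReal) P where
  aemeasurable := hX.aemeasurable
  map_eq := by rw [hX.map_eq_gaussianReal, h0]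

/-- An almost sure limit of centered Gaussian processes is a Gaussian process. -/
lemma isGaussianProcess_of_tendsto [IsProbabilityMeasure P] {T : Type*} {X : ℕ → T → Ω → ℝ} {Y : T → Ω → ℝ}
    (hX : ∀ n, IsGaussianProcess (X n) P) (h0 : ∀ n t, ∫ ω, X n t ω ∂P = 0)
    (hlim : ∀ t, ∀ᵐ ω ∂P, Filter.Tendsto (X · t ω) Filter.atTop (nhds (Y t ω))) :
    IsGaussianProcess Y P where
  hasGaussianLaw I := by
    classical
    have hYm : ∀ t, AEMeasurable (Y t) P := fun t ↦
      aemeasurable_of_tendsto_metrizable_ae' (fun n ↦ (hX n).aemeasurable t) (hlim t)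
    have hYI : AEMeasurable (fun ω ↦ I.restrict (Y · ω)) P :=
      aemeasurable_pi_lambda _ fun t ↦ hYm t
    refine ⟨isGaussian_of_isGaussian_map fun L ↦ ?_⟩
    rw [AEMeasurable.map_map_of_aemeasurable (by fun_prop) hYI]
    have hsum : ∀ f : I → ℝ, L f = ∑ i, f i * L (Pi.single i 1) := fun f ↦ by
      conv_lhs => rw [← Finset.univ_sum_single f]
      rw [map_sum]
      refine Finset.sum_congr rfl fun i _ ↦ ?_
      rw [← smul_eq_mul, ← map_smul, ← Pi.single_smul, smul_eq_mul, mul_one]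
    have hXL : ∀ n, HasGaussianLaw (fun ω ↦ L (I.restrict (X n · ω))) P :=
      fun n ↦ ((hX n).hasGaussianLaw I).map_fun L
    have hXL0 : ∀ n, ∫ ω, L (I.restrict (X n · ω)) ∂P = 0 := fun n ↦ by
      rw [show (fun ω ↦ L (I.restrict (X n · ω))) =
        fun ω ↦ ∑ i : I, X n i ω * L (Pi.single i 1) from funext fun ω ↦ hsum _]
      rw [integral_finsetSum _ fun i _ ↦ ((hX n).hasGaussianLaw_eval _).integrable.mul_const _]
      refine Finset.sum_eq_zero fun i _ ↦ ?_
      rw [integral_mul_const, h0, zero_mul]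
    obtain ⟨w, hw, -⟩ := exists_gaussianReal_limit
      (fun n ↦ hasLaw_gaussianReal_of_integral_eq_zero (hXL n) (hXL0 n))
      (Y := fun ω ↦ L (I.restrict (Y · ω))) (by
        have : ∀ᵐ ω ∂P, ∀ t : I, Filter.Tendsto (X · t ω) Filter.atTop (nhds (Y t ω)) :=
          ae_all_iff.2 fun t ↦ hlim t
        filter_upwards [this] with ω hω
        exact (L.continuous.tendsto _).comp (tendsto_pi_nhds.2 hω))
    have := hw.map_eq
    change IsGaussian (P.map fun ω ↦ L (I.restrict (Y · ω)))
    rw [this]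
    infer_instance

/-- The first four moments of a centered Gaussian variable. -/
lemma gaussianReal_moments {X : Ω → ℝ} {v : ℝ≥0} (hX : HasLaw X (gaussianReal 0 v) P) :
    ∫ ω, X ω ∂P = 0 ∧ ∫ ω, X ω ^ 2 ∂P = v ∧ ∫ ω, X ω ^ 3 ∂P = 0 ∧
      ∫ ω, X ω ^ 4 ∂P = 3 * (v : ℝ) ^ 2 := by
  have key : ∀ n, ∫ ω, X ω ^ n ∂P = iteratedDeriv n (fun t : ℝ ↦ Real.exp (v * t ^ 2 / 2)) 0 := by
    intro n
    have h1 : ∫ ω, X ω ^ n ∂P = ∫ x, x ^ n ∂(gaussianReal 0 v) := by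
      rw [← hX.map_eq, integral_map hX.aemeasurable (by fun_prop)]
    have h2 := iteratedDeriv_mgf_zero (X := id) (μ := gaussianReal 0 v)
      (by rw [integrableExpSet_id_gaussianReal]; simp) n
    rw [h1, show ∫ x, x ^ n ∂(gaussianReal 0 v) = (gaussianReal 0 v)[id ^ n] from rfl, ← h2,
      mgf_id_gaussianReal]
    simp
  -- Differentiation maps `p exp(vt²/2)` to `(p' + vtp) exp(vt²/2)`, so the derivatives of the
  -- moment generating function reduce to a recursion on the polynomial factor.
  have d : ∀ (p p' : ℝ → ℝ), (∀ t, HasDerivAt p (p' t) t) →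
      deriv (fun t : ℝ ↦ p t * Real.exp (v * t ^ 2 / 2)) =
        fun t ↦ (p' t + p t * (v * t)) * Real.exp (v * t ^ 2 / 2) := by
    intro p p' hp
    funext t
    have := (hp t).mul ((((hasDerivAt_id t).pow 2).const_mul (v : ℝ)).div_const 2).exp
    refine (this.congr_deriv ?_).deriv
    simp only [id, Pi.pow_apply]
    push_cast
    ring
  have d0 : (fun t : ℝ ↦ Real.exp (v * t ^ 2 / 2)) =
      fun t ↦ (1 : ℝ) * Real.exp (v * t ^ 2 / 2) := by simp
  have i1 : iteratedDeriv 1 (fun t : ℝ ↦ Real.exp (v * t ^ 2 / 2)) =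
      fun t ↦ (v * t) * Real.exp (v * t ^ 2 / 2) := by
    rw [iteratedDeriv_one, d0, d (fun _ ↦ 1) (fun _ ↦ 0) fun t ↦ hasDerivAt_const _ _]
    simp
  have i2 : iteratedDeriv 2 (fun t : ℝ ↦ Real.exp (v * t ^ 2 / 2)) =
      fun t ↦ (v + v ^ 2 * t ^ 2) * Real.exp (v * t ^ 2 / 2) := by
    rw [iteratedDeriv_succ, i1, d (fun t ↦ v * t) (fun _ ↦ v * 1)
      fun t ↦ (hasDerivAt_id t).const_mul _]
    funext t; ring
  have i3 : iteratedDeriv 3 (fun t : ℝ ↦ Real.exp (v * t ^ 2 / 2)) =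
      fun t ↦ (3 * v ^ 2 * t + v ^ 3 * t ^ 3) * Real.exp (v * t ^ 2 / 2) := by
    rw [iteratedDeriv_succ, i2, d (fun t ↦ v + v ^ 2 * t ^ 2) (fun t ↦ v ^ 2 * (2 * t))
      fun t ↦ by simpa using ((hasDerivAt_pow 2 t).const_mul ((v : ℝ) ^ 2)).const_add (v : ℝ)]
    funext t; ring
  have i4 : iteratedDeriv 4 (fun t : ℝ ↦ Real.exp (v * t ^ 2 / 2)) =
      fun t ↦ (3 * v ^ 2 + 6 * v ^ 3 * t ^ 2 + v ^ 4 * t ^ 4) * Real.exp (v * t ^ 2 / 2) := by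
    rw [iteratedDeriv_succ, i3, d (fun t ↦ 3 * v ^ 2 * t + v ^ 3 * t ^ 3)
      (fun t ↦ 3 * v ^ 2 * 1 + v ^ 3 * (3 * t ^ 2))
      fun t ↦ by
        simpa using ((hasDerivAt_id t).const_mul (3 * (v : ℝ) ^ 2)).fun_add
          ((hasDerivAt_pow 3 t).const_mul ((v : ℝ) ^ 3))]
    funext t; ring
  refine ⟨?_, ?_, ?_, ?_⟩
  · simpa [i1] using key 1
  · simpa [i2] using key 2
  · simpa [i3] using key 3
  · simpa [i4] using key 4

end GaussianLimit

/-- Generalized Riemann sums: `∑ h(ξᵢ) ∫_{gᵢ}^{gᵢ₊₁} f → ∫ f h` on `[s, s + d]`. -/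
lemma tendsto_sum_mul_integral {f h : ℝ → ℝ} (hf : Continuous f) (hh : Continuous h) {s d : ℝ}
    (hd : 0 ≤ d) {ξ : ℕ → ℕ → ℝ}
    (hξ : ∀ n i : ℕ, ξ n i ∈ Icc (s + i * (d / (n + 1))) (s + (i + 1 : ℕ) * (d / (n + 1)))) :
    Filter.Tendsto (fun n : ℕ ↦ ∑ i ∈ Finset.range (n + 1), h (ξ n i) *
      ∫ u in (s + i * (d / (n + 1)))..(s + (i + 1 : ℕ) * (d / (n + 1))), f u)
      Filter.atTop (nhds (∫ u in s..(s + d), f u * h u)) := by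
  rw [Metric.tendsto_atTop]
  intro ε hε
  set A : ℝ := ∫ u in s..(s + d), |f u| with hA
  have hA0 : 0 ≤ A := intervalIntegral.integral_nonneg (by linarith) fun u _ ↦ abs_nonneg _
  have huc : UniformContinuousOn h (Icc s (s + d)) :=
    isCompact_Icc.uniformContinuousOn_of_continuous hh.continuousOn
  rw [Metric.uniformContinuousOn_iff] at huc
  -- The denominator is `A + 1` because `A` may vanish.
  obtain ⟨δ, hδ, huc⟩ := huc (ε / (A + 1)) (by positivity)
  obtain ⟨N, hN⟩ := exists_nat_gt (d / δ)
  refine ⟨N, fun n hn ↦ ?_⟩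
  have hn1 : (0 : ℝ) < n + 1 := by positivity
  have hstep : d / (n + 1) < δ := by
    rw [div_lt_iff₀ hn1]
    rw [div_lt_iff₀ hδ] at hN
    have : (N : ℝ) ≤ n := by exact_mod_cast hn
    nlinarith
  set g : ℕ → ℝ := fun i ↦ s + i * (d / (n + 1)) with hg
  have hstep0 : 0 ≤ d / (n + 1) := by positivity
  have hgm : Monotone g := fun i j hij ↦ by
    simp only [hg]; gcongr
  have hg0 : g 0 = s := by simp [hg]
  have hgn : g (n + 1) = s + d := by
    simp only [hg]; push_cast; field_simp
  have hint : ∀ F : ℝ → ℝ, Continuous F → ∫ u in s..(s + d), F u =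
      ∑ i ∈ Finset.range (n + 1), ∫ u in g i..g (i + 1), F u := fun F hF ↦ by
    rw [intervalIntegral.sum_integral_adjacent_intervals
      fun k _ ↦ hF.intervalIntegrable _ _, hg0, hgn]
  rw [hint _ (by fun_prop), Real.dist_eq, ← Finset.sum_sub_distrib]
  calc |∑ i ∈ Finset.range (n + 1), (h (ξ n i) * (∫ u in g i..g (i + 1), f u)
          - ∫ u in g i..g (i + 1), f u * h u)|
      ≤ ∑ i ∈ Finset.range (n + 1), ∫ u in g i..g (i + 1), |f u| * (ε / (A + 1)) := by
        refine (Finset.abs_sum_le_sum_abs _ _).trans (Finset.sum_le_sum fun i hi ↦ ?_)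
        have hle : g i ≤ g (i + 1) := hgm (Nat.le_succ i)
        rw [← intervalIntegral.integral_const_mul, ← intervalIntegral.integral_sub
          (Continuous.intervalIntegrable (by fun_prop) _ _)
          (Continuous.intervalIntegrable (by fun_prop) _ _)]
        refine (intervalIntegral.abs_integral_le_integral_abs hle).trans
          (intervalIntegral.integral_mono_on hle
            (Continuous.intervalIntegrable (by fun_prop) _ _)
            (Continuous.intervalIntegrable (by fun_prop) _ _) fun u hu ↦ ?_)
        have hi' : i + 1 ≤ n + 1 := Finset.mem_range.1 hi
        have h1 : s ≤ g i := hg0 ▸ hgm (Nat.zero_le i)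
        have h2 : g (i + 1) ≤ s + d := hgn ▸ hgm hi'
        have h3 : ξ n i ∈ Icc (g i) (g (i + 1)) := hξ n i
        have h4 : g (i + 1) - g i < δ := by
          simp only [hg]; push_cast; linarith
        have h5 := huc (ξ n i) ⟨by linarith [h3.1], by linarith [h3.2]⟩ u
          ⟨by linarith [hu.1], by linarith [hu.2]⟩ (by
            rw [Real.dist_eq, abs_lt]
            constructor <;> linarith [h3.1, h3.2, hu.1, hu.2])
        rw [Real.dist_eq] at h5
        rw [show h (ξ n i) * f u - f u * h u = f u * (h (ξ n i) - h u) by ring, abs_mul]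
        gcongr
    _ = A * (ε / (A + 1)) := by
        rw [← hint _ (by fun_prop), intervalIntegral.integral_mul_const]
    _ < ε := by
        rw [mul_div_assoc', div_lt_iff₀ (by positivity)]
        nlinarith

/-! ### Wiener integrals of deterministic `C¹` functions -/

/-- The points of the uniform grid of step `d / (n + 1)` starting from `s`. -/
noncomputable def gridPt (s d : ℝ≥0) (n i : ℕ) : ℝ≥0 := s + i * (d / (n + 1))

lemma gridPt_mono (s d : ℝ≥0) (n : ℕ) : Monotone (gridPt s d n) := fun i j hij ↦ by
  unfold gridPt; gcongr

lemma gridPt_zero (s d : ℝ≥0) (n : ℕ) : gridPt s d n 0 = s := by simp [gridPt]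

lemma gridPt_last (s d : ℝ≥0) (n : ℕ) : gridPt s d n (n + 1) = s + d := by
  have : (n : ℝ≥0) + 1 ≠ 0 := by positivity
  simp only [gridPt]; push_cast; field_simp

lemma coe_gridPt (s d : ℝ≥0) (n i : ℕ) :
    (gridPt s d n i : ℝ) = s + i * ((d : ℝ) / (n + 1)) := by simp [gridPt]

section Wiener

variable {Ω : Type*}

/-- Riemann sums for the Wiener integral of `ψ` over `[s, s + d]`. -/
noncomputable def wienerSum (ψ : ℝ → ℝ) (B : ℝ≥0 → Ω → ℝ) (s d : ℝ≥0) (n : ℕ) (ω : Ω) : ℝ :=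
  ∑ i ∈ Finset.range (n + 1),
    ψ (gridPt s d n i) * (B (gridPt s d n (i + 1)) ω - B (gridPt s d n i) ω)

/-- The Wiener integral `∫₀ᵗ ψ dB` of a `C¹` function with derivative `ψ'`, defined pathwise by
integration by parts. -/
noncomputable def wienerIntegral (ψ ψ' : ℝ → ℝ) (B : ℝ≥0 → Ω → ℝ) (t : ℝ≥0) (ω : Ω) : ℝ :=
  ψ t * B t ω - ∫ u in (0 : ℝ)..t, ψ' u * B u.toNNReal ω

variable {ψ ψ' : ℝ → ℝ} {B : ℝ≥0 → Ω → ℝ}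

/-- Abel summation moves the differences from `B` to `ψ`. What remains besides the boundary terms is
a Riemann sum of `ψ' B`, with `B` taken at the right end of each cell. -/
lemma tendsto_wienerSum (hψ : ∀ t, HasDerivAt ψ (ψ' t) t) (hψ' : Continuous ψ') {ω : Ω}
    (hB : Continuous (B · ω)) (s d : ℝ≥0) :
    Filter.Tendsto (wienerSum ψ B s d · ω) Filter.atTop
      (nhds (wienerIntegral ψ ψ' B (s + d) ω - wienerIntegral ψ ψ' B s ω)) := by
  have hb : Continuous fun u : ℝ ↦ B u.toNNReal ω := hB.comp continuous_real_toNNReal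
  have key := tendsto_sum_mul_integral hψ' hb (s := s) (d := d) d.2
    (ξ := fun n i ↦ gridPt s d n (i + 1)) fun n i ↦ by
      rw [coe_gridPt]
      refine ⟨?_, le_rfl⟩
      gcongr
      exact Nat.le_succ i
  have heq : ∀ n, wienerSum ψ B s d n ω =
      (ψ (s + d : ℝ≥0) * B (s + d) ω - ψ s * B s ω) - ∑ i ∈ Finset.range (n + 1),
        B (gridPt s d n (i + 1) : ℝ).toNNReal ω *
          ∫ u in ((s : ℝ) + i * ((d : ℝ) / (n + 1)))..(s + (i + 1 : ℕ) * ((d : ℝ) / (n + 1))),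
            ψ' u := by
    intro n
    have h1 := Finset.sum_range_sub
      (fun i ↦ ψ (gridPt s d n i) * B (gridPt s d n i) ω) (n + 1)
    rw [gridPt_zero, gridPt_last] at h1
    rw [← h1, ← Finset.sum_sub_distrib, wienerSum]
    refine Finset.sum_congr rfl fun i _ ↦ ?_
    rw [intervalIntegral.integral_eq_sub_of_hasDerivAt (fun x _ ↦ hψ x)
      (hψ'.intervalIntegrable _ _), ← coe_gridPt, ← coe_gridPt, Real.toNNReal_coe]
    ring
  simp_rw [heq]
  have hlim : wienerIntegral ψ ψ' B (s + d) ω - wienerIntegral ψ ψ' B s ω =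
      (ψ (s + d : ℝ≥0) * B (s + d) ω - ψ s * B s ω) -
        ∫ u in (s : ℝ)..(s + d), ψ' u * B u.toNNReal ω := by
    have hc : Continuous fun u ↦ ψ' u * B u.toNNReal ω := hψ'.mul hb
    rw [wienerIntegral, wienerIntegral, ← intervalIntegral.integral_add_adjacent_intervals
      (hc.intervalIntegrable 0 s) (hc.intervalIntegrable s (s + d : ℝ≥0))]
    push_cast
    ring
  rw [hlim]
  exact tendsto_const_nhds.sub key

variable [MeasurableSpace Ω] {P : Measure Ω}

/-- The index of the process is the length `d`. Each value is a fixed linear combination of `B` at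
the `n + 2` grid points. -/
lemma wienerSum_isGaussianProcess (hB : IsGaussianProcess B P) (ψ : ℝ → ℝ) (s : ℝ≥0) (n : ℕ) :
    IsGaussianProcess (fun d ω ↦ wienerSum ψ B s d n ω) P := by
  classical
  refine hB.of_isGaussianProcess fun d ↦
    ⟨(Finset.range (n + 2)).image (gridPt s d n), ?_⟩
  have hm : ∀ i, i < n + 2 → gridPt s d n i ∈ (Finset.range (n + 2)).image (gridPt s d n) :=
    fun i hi ↦ Finset.mem_image_of_mem _ (Finset.mem_range.2 hi)
  refine ⟨∑ i : Fin (n + 1), ψ (gridPt s d n i) •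
    (ContinuousLinearMap.proj ⟨gridPt s d n (i + 1), hm _ (by omega)⟩ -
      ContinuousLinearMap.proj ⟨gridPt s d n i, hm _ (by omega)⟩), fun ω ↦ ?_⟩
  simp [wienerSum, Finset.sum_range]

lemma integral_wienerSum (hB : IsPreBrownianReal B P) (s d : ℝ≥0) (n : ℕ) :
    ∫ ω, wienerSum ψ B s d n ω ∂P = 0 := by
  simp only [wienerSum]
  rw [integral_finsetSum]
  · refine Finset.sum_eq_zero fun i _ ↦ ?_
    rw [integral_const_mul, integral_sub (hB.integrable_eval _) (hB.integrable_eval _),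
      hB.integral_eval, hB.integral_eval]
    simp
  · exact fun i _ ↦ ((hB.integrable_eval _).sub (hB.integrable_eval _)).const_mul _

/-- Increments over different cells are independent, so variances add. The cell length is written as
the integral of `1` to fit `tendsto_sum_mul_integral`. -/
lemma variance_wienerSum (hB : IsPreBrownianReal B P) (s d : ℝ≥0) (n : ℕ) :
    Var[wienerSum ψ B s d n; P] = ∑ i ∈ Finset.range (n + 1), ψ (gridPt s d n i) ^ 2 *
      ∫ _u in ((s : ℝ) + i * ((d : ℝ) / (n + 1)))..(s + (i + 1 : ℕ) * ((d : ℝ) / (n + 1))),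
        (1 : ℝ) := by
  have hind := hB.hasIndepIncrements.nat (gridPt_mono s d n)
  have hP := hB.isGaussianProcess.isProbabilityMeasure
  have hfun : wienerSum ψ B s d n = ∑ i ∈ Finset.range (n + 1), fun ω ↦
      ψ (gridPt s d n i) * (B (gridPt s d n (i + 1)) ω - B (gridPt s d n i) ω) := by
    funext ω; simp [wienerSum]
  rw [hfun, IndepFun.variance_sum]
  · refine Finset.sum_congr rfl fun i _ ↦ ?_
    have h1 := (hB.hasLaw_sub (gridPt s d n (i + 1)) (gridPt s d n i)).variance_eq
    rw [variance_id_gaussianReal] at h1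
    change Var[fun ω ↦ B (gridPt s d n (i + 1)) ω - B (gridPt s d n i) ω; P] = _ at h1
    rw [variance_const_mul, h1, intervalIntegral.integral_const, ← coe_gridPt, ← coe_gridPt]
    have h2 : gridPt s d n i ≤ gridPt s d n (i + 1) := gridPt_mono s d n (Nat.le_succ i)
    have h3 : (gridPt s d n i : ℝ) ≤ gridPt s d n (i + 1) := by exact_mod_cast h2
    rw [coe_nndist, Real.dist_eq]
    change _ * |(gridPt s d n (i + 1) : ℝ) - gridPt s d n i| = _
    rw [abs_of_nonneg (sub_nonneg.2 h3), smul_eq_mul, mul_one]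
  · exact fun i _ ↦ (hB.isGaussianProcess.hasGaussianLaw_sub.memLp_two).const_mul _
  · intro i _ j _ hij
    exact (hind.indepFun hij).comp (measurable_const_mul _) (measurable_const_mul _)

lemma wienerIntegral_sub_hasLaw (hB : IsBrownianReal B P) (hψ : ∀ t, HasDerivAt ψ (ψ' t) t)
    (hψ' : Continuous ψ') (s d : ℝ≥0) :
    HasLaw (fun ω ↦ wienerIntegral ψ ψ' B (s + d) ω - wienerIntegral ψ ψ' B s ω)
      (gaussianReal 0 (∫ u in (s : ℝ)..(s + d), ψ u ^ 2).toNNReal) P := by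
  have hP := hB.isGaussianProcess.isProbabilityMeasure
  have hψc : Continuous ψ := continuous_iff_continuousAt.2 fun t ↦ (hψ t).continuousAt
  obtain ⟨w, hw, hv⟩ := exists_gaussianReal_limit (P := P) (X := wienerSum ψ B s d)
    (Y := fun ω ↦ wienerIntegral ψ ψ' B (s + d) ω - wienerIntegral ψ ψ' B s ω)
    (fun n ↦ hasLaw_gaussianReal_of_integral_eq_zero
      ((wienerSum_isGaussianProcess hB.isGaussianProcess ψ s n).hasGaussianLaw_eval d)
      (integral_wienerSum hB.toIsPreBrownianReal s d n))
    (hB.cont.mono fun ω hω ↦ tendsto_wienerSum hψ hψ' hω s d)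
  have hv2 := tendsto_sum_mul_integral (f := fun _ ↦ 1) (h := fun u ↦ ψ u ^ 2) continuous_const
    (by fun_prop) (s := s) (d := d) d.2 (ξ := fun n i ↦ gridPt s d n i) fun n i ↦ by
      rw [coe_gridPt]
      refine ⟨le_rfl, ?_⟩
      gcongr
      exact Nat.le_succ i
  simp only [← variance_wienerSum hB.toIsPreBrownianReal, one_mul] at hv2
  rwa [tendsto_nhds_unique hv
    ((continuous_real_toNNReal.tendsto _).comp hv2)] at hw

lemma wienerIntegral_zero (hB : IsPreBrownianReal B P) (ψ ψ' : ℝ → ℝ) :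
    ∀ᵐ ω ∂P, wienerIntegral ψ ψ' B 0 ω = 0 := by
  filter_upwards [hB.eval_zero_ae_eq_zero] with ω hω
  simp [wienerIntegral, hω]

lemma wienerIntegral_hasLaw (hB : IsBrownianReal B P) (hψ : ∀ t, HasDerivAt ψ (ψ' t) t)
    (hψ' : Continuous ψ') (t : ℝ≥0) :
    HasLaw (wienerIntegral ψ ψ' B t)
      (gaussianReal 0 (∫ u in (0 : ℝ)..t, ψ u ^ 2).toNNReal) P := by
  have h := wienerIntegral_sub_hasLaw hB hψ hψ' 0 t
  simp only [zero_add, NNReal.coe_zero] at h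
  refine h.congr ?_
  filter_upwards [wienerIntegral_zero hB.toIsPreBrownianReal ψ ψ'] with ω hω
  simp [hω]

lemma wienerIntegral_isGaussianProcess (hB : IsBrownianReal B P)
    (hψ : ∀ t, HasDerivAt ψ (ψ' t) t) (hψ' : Continuous ψ') :
    IsGaussianProcess (wienerIntegral ψ ψ' B) P := by
  have hP := hB.isGaussianProcess.isProbabilityMeasure
  refine isGaussianProcess_of_tendsto (X := fun n d ω ↦ wienerSum ψ B 0 d n ω)
    (fun n ↦ wienerSum_isGaussianProcess hB.isGaussianProcess ψ 0 n)
    (fun n d ↦ integral_wienerSum hB.toIsPreBrownianReal 0 d n) fun d ↦ ?_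
  filter_upwards [hB.cont, wienerIntegral_zero hB.toIsPreBrownianReal ψ ψ'] with ω h1 h2
  have := tendsto_wienerSum hψ hψ' h1 0 d
  rwa [zero_add, h2, sub_zero] at this

/-- The Wiener integral has orthogonal increments. -/
lemma covariance_wienerIntegral (hB : IsBrownianReal B P) (hψ : ∀ t, HasDerivAt ψ (ψ' t) t)
    (hψ' : Continuous ψ') {s t : ℝ≥0} (hst : s ≤ t) :
    cov[wienerIntegral ψ ψ' B s, wienerIntegral ψ ψ' B t; P] =
      Var[wienerIntegral ψ ψ' B s; P] := by
  have hP := hB.isGaussianProcess.isProbabilityMeasure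
  have hψc : Continuous ψ := continuous_iff_continuousAt.2 fun t ↦ (hψ t).continuousAt
  have hG := wienerIntegral_isGaussianProcess hB hψ hψ'
  have hL2 := fun t ↦ (hG.hasGaussianLaw_eval t).memLp_two
  have hvar : ∀ t : ℝ≥0, Var[wienerIntegral ψ ψ' B t; P] = ∫ u in (0 : ℝ)..t, ψ u ^ 2 := fun t ↦ by
    rw [(wienerIntegral_hasLaw hB hψ hψ' t).variance_eq, variance_id_gaussianReal]
    exact Real.coe_toNNReal _ (intervalIntegral.integral_nonneg t.2 fun _ _ ↦ sq_nonneg _)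
  obtain ⟨d, rfl⟩ := exists_add_of_le hst
  -- Expanding the variance of the increment as `Var + Var - 2 cov` and comparing with the
  -- additivity of `∫ψ²` determines the covariance; independence of the increments of the integral
  -- is not needed.
  have h1 := (wienerIntegral_sub_hasLaw hB hψ hψ' s d).variance_eq
  rw [variance_id_gaussianReal, Real.coe_toNNReal _
    (intervalIntegral.integral_nonneg (by simp) fun _ _ ↦ sq_nonneg _),
    variance_fun_sub (hL2 _) (hL2 _), hvar, hvar, covariance_comm] at h1
  have hc : Continuous fun u ↦ ψ u ^ 2 := by fun_prop
  have h2 := intervalIntegral.integral_add_adjacent_intervals (hc.intervalIntegrable (μ := volume)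
    0 s) (hc.intervalIntegrable s (s + d : ℝ≥0))
  rw [hvar]
  push_cast at h1 h2
  linarith

end Wiener

/-! ### The Markov property of Gaussian processes -/

section Markov

/-- This presents the past as generated by one random variable, the path restricted to `[0, s]`, so
that independence and conditional distributions apply to it. -/
lemma pastSigma_eq_comap {Ω : Type*} {X : ℝ≥0 → Ω → ℝ} (s : ℝ≥0) :
    pastSigma X s = MeasurableSpace.comap (fun ω (r : Iic s) ↦ X r ω) inferInstance := by
  change _ = MeasurableSpace.comap _ MeasurableSpace.pi
  simp only [pastSigma, MeasurableSpace.pi, MeasurableSpace.comap_iSup,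
    MeasurableSpace.comap_comp, iSup_subtype]
  rfl

variable {Ω : Type*} [MeasurableSpace Ω] {P : Measure Ω} [IsProbabilityMeasure P]

/-- Conditional expectation of a function of `X` and of a variable independent of `X`. -/
lemma condExp_prod_ae_eq_of_indepFun {β : Type*} [mβ : MeasurableSpace β] {X : Ω → β} {R : Ω → ℝ}
    (hX : Measurable X) (hR : Measurable R) (hXR : IndepFun X R P) {f : β × ℝ → ℝ}
    (hf : StronglyMeasurable f) (hfi : Integrable (fun ω ↦ f (X ω, R ω)) P) :
    P[fun ω ↦ f (X ω, R ω) | mβ.comap X] =ᵐ[P] fun ω ↦ ∫ y, f (X ω, y) ∂(P.map R) := by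
  have : IsProbabilityMeasure (P.map R) := Measure.isProbabilityMeasure_map hR.aemeasurable
  have hκ : condDistrib R X P =ᵐ[P.map X] Kernel.const β (P.map R) := by
    refine condDistrib_ae_eq_of_measure_eq_compProd X hR.aemeasurable ?_
    rw [Measure.compProd_const]
    exact (indepFun_iff_map_prod_eq_prod_map_map hX.aemeasurable hR.aemeasurable).1 hXR
  filter_upwards [condExp_prod_ae_eq_integral_condDistrib hX hR.aemeasurable hf hfi,
    ae_of_ae_map hX.aemeasurable hκ] with ω h1 h2
  rw [h1, h2, Kernel.const_apply]

/-- A Gaussian process is Markov if for `s ≤ t` the covariances with the value at time `t` are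
proportional to those with the value at time `s` on the past of `s`. -/
lemma isMarkovReal_of_covariance {X : ℝ≥0 → Ω → ℝ} (hXm : ∀ t, Measurable (X t))
    (hX : IsGaussianProcess X P)
    (hcov : ∀ s t : ℝ≥0, s ≤ t → ∃ c : ℝ, ∀ r ≤ s, cov[X r, X t; P] = c * cov[X r, X s; P]) :
    IsMarkovReal X P where
  measurable := hXm
  markov s t hst A hA := by
    obtain ⟨c, hc⟩ := hcov s t hst
    have hL2 := fun t ↦ (hX.hasGaussianLaw_eval t).memLp_two
    set R : Ω → ℝ := fun ω ↦ X t ω - c * X s ω with hRdef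
    have hRm : Measurable R := (hXm t).sub ((hXm s).const_mul c)
    set X' : Ω → Iic s → ℝ := fun ω r ↦ X r ω with hX'
    have hX'm : Measurable X' := measurable_pi_lambda _ fun r ↦ hXm r
    -- The residual `R` is uncorrelated with the past by the choice of `c`, and jointly Gaussian
    -- with it, hence independent of it.
    have hind : IndepFun X' R P := by
      have h1 : IndepFun (fun ω (r : Iic s) ↦ X r ω) (fun ω (_ : Unit) ↦ R ω) P := by
        refine IsGaussianProcess.indepFun_of_covariance_eq_zero ?_
          (fun r ↦ (hXm r).aemeasurable) (fun _ ↦ hRm.aemeasurable) ?_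
        · refine hX.of_isGaussianProcess ?_
          classical
          rintro (r | _)
          · exact ⟨{(r : ℝ≥0)}, ContinuousLinearMap.proj ⟨r, by simp⟩, by simp⟩
          · exact ⟨{s, t}, ContinuousLinearMap.proj ⟨t, by simp⟩ -
              c • ContinuousLinearMap.proj ⟨s, by simp⟩, by simp [hRdef]⟩
        · rintro r -
          rw [hRdef, covariance_fun_sub_right (hL2 _) (hL2 _) ((hL2 _).const_mul c),
            covariance_const_mul_right]
          exact sub_eq_zero.2 (hc r r.2)
      exact h1.comp measurable_id (measurable_pi_apply ())
    set f : ℝ × ℝ → ℝ := fun p ↦ (A.indicator fun _ ↦ (1 : ℝ)) (p.2 + c * p.1) with hf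
    have hfm : StronglyMeasurable f :=
      ((measurable_const.indicator hA).comp (by fun_prop)).stronglyMeasurable
    have hfeq : (X t ⁻¹' A).indicator (fun _ ↦ (1 : ℝ)) = fun ω ↦ f (X s ω, R ω) := by
      funext ω
      simp only [hf, hRdef, sub_add_cancel]
      rfl
    have hfi : Integrable (fun ω ↦ f (X s ω, R ω)) P := by
      rw [← hfeq]
      exact (integrable_const (1 : ℝ)).indicator (hXm t hA)
    -- Given the whole past or `X s` alone, the conditional expectation is the same integral of `f
    -- (X s, ·)` against the law of `R`.
    have e1 := condExp_prod_ae_eq_of_indepFun hX'm hRm hind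
      (f := fun p : (Iic s → ℝ) × ℝ ↦ f (p.1 ⟨s, mem_Iic.2 le_rfl⟩, p.2))
      (hfm.comp_measurable (((measurable_pi_apply _).comp measurable_fst).prodMk measurable_snd))
      hfi
    have e2 := condExp_prod_ae_eq_of_indepFun (hXm s) hRm
      (hind.comp (measurable_pi_apply (⟨s, mem_Iic.2 le_rfl⟩ : Iic s)) measurable_id) hfm hfi
    rw [hfeq, pastSigma_eq_comap]
    exact e1.trans e2.symm

end Markov

lemma isGaussianProcess_const_add {Ω T : Type*} [MeasurableSpace Ω] {P : Measure Ω}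
    {X : T → Ω → ℝ} (hX : IsGaussianProcess X P) (c : T → ℝ) :
    IsGaussianProcess (fun t ω ↦ c t + X t ω) P where
  hasGaussianLaw I := by
    have h := hX.hasGaussianLaw I
    have h1 := h.isGaussian_map
    refine ⟨?_⟩
    have h2 : P.map (fun ω ↦ I.restrict fun t ↦ c t + X t ω) =
        (P.map fun ω ↦ I.restrict (X · ω)).map fun x ↦ I.restrict c + x := by
      rw [AEMeasurable.map_map_of_aemeasurable (by fun_prop) h.aemeasurable]
      rfl
    rw [h2]
    infer_instance

/-! ### Linear equations with additive noise -/

/-- The integrating factor `exp(-∫₀ᵗ a)`. -/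
noncomputable def integratingFactor (a : ℝ → ℝ) (t : ℝ) : ℝ := Real.exp (-∫ u in (0 : ℝ)..t, a u)

lemma integratingFactor_pos (a : ℝ → ℝ) (t : ℝ) : 0 < integratingFactor a t := Real.exp_pos _

section LinearEquation

variable {a : ℝ → ℝ}

lemma hasDerivAt_integratingFactor (ha : Continuous a) (t : ℝ) :
    HasDerivAt (integratingFactor a) (-a t * integratingFactor a t) t := by
  have := ((intervalIntegral.integral_hasDerivAt_right (ha.intervalIntegrable 0 t)
    (ha.stronglyMeasurableAtFilter _ _) ha.continuousAt).neg).exp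
  refine this.congr_deriv ?_
  simp only [integratingFactor, Pi.neg_apply]
  ring

lemma continuous_integratingFactor (ha : Continuous a) : Continuous (integratingFactor a) :=
  continuous_iff_continuousAt.2 fun t ↦ (hasDerivAt_integratingFactor ha t).continuousAt

/-- The solution of `z' = a z + b'` on `[0, T]` is obtained by variation of constants; `b` need
not be differentiable. -/
lemma variation_of_constants (ha : Continuous a) {b z : ℝ → ℝ} (hb : Continuous b)
    (hz : Continuous z) {T : ℝ} (hT : 0 ≤ T)
    (h : ∀ t ∈ Icc 0 T, z t = (∫ u in (0 : ℝ)..t, a u * z u) + b t) :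
    integratingFactor a T * z T = integratingFactor a T * b T -
      ∫ u in (0 : ℝ)..T, -a u * integratingFactor a u * b u := by
  have hc := continuous_integratingFactor ha
  -- Only `∫ a z` is differentiated, not `z`. With `ψ` the integrating factor, the derivative is `ψ
  -- a (z - ∫ a z) = ψ a b`.
  have hd : ∀ t ∈ uIcc 0 T, HasDerivAt
      (fun t ↦ integratingFactor a t * ∫ u in (0 : ℝ)..t, a u * z u)
      (-(-a t * integratingFactor a t * b t)) t := by
    intro t ht
    rw [uIcc_of_le hT] at ht
    have haz : Continuous fun u ↦ a u * z u := ha.mul hz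
    have := (hasDerivAt_integratingFactor ha t).mul
      (intervalIntegral.integral_hasDerivAt_right (haz.intervalIntegrable 0 t)
        (haz.stronglyMeasurableAtFilter _ _) haz.continuousAt)
    refine this.congr_deriv ?_
    rw [show z t = _ from h t ht]
    ring
  have hint := intervalIntegral.integral_eq_sub_of_hasDerivAt hd
    (Continuous.intervalIntegrable (by fun_prop) _ _)
  rw [intervalIntegral.integral_same, mul_zero, sub_zero, intervalIntegral.integral_neg] at hint
  rw [h T ⟨hT, le_rfl⟩]
  linarith

/-- The difference `z - b = -ψ⁻¹J`, with `ψ` the integrating factor and `J` the integral in the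
formula, is differentiable with derivative `a z`, although `z` and `b` need not be. -/
lemma solves_of_variation_of_constants (ha : Continuous a) {b z : ℝ → ℝ} (hb : Continuous b)
    (h : ∀ t, integratingFactor a t * z t = integratingFactor a t * b t -
      ∫ u in (0 : ℝ)..t, -a u * integratingFactor a u * b u) (T : ℝ) :
    z T = (∫ u in (0 : ℝ)..T, a u * z u) + b T := by
  have hc := continuous_integratingFactor ha
  set J : ℝ → ℝ := fun t ↦ ∫ u in (0 : ℝ)..t, -a u * integratingFactor a u * b u with hJ
  have hJc : Continuous fun u ↦ -a u * integratingFactor a u * b u := by fun_prop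
  have hz : ∀ t, z t = b t - (integratingFactor a t)⁻¹ * J t := fun t ↦ by
    have := (integratingFactor_pos a t).ne'
    field_simp
    linarith [h t]
  have hJd : ∀ t, HasDerivAt J (-a t * integratingFactor a t * b t) t := fun t ↦
    intervalIntegral.integral_hasDerivAt_right (hJc.intervalIntegrable 0 t)
      (hJc.stronglyMeasurableAtFilter _ _) hJc.continuousAt
  have hJcont : Continuous J := continuous_iff_continuousAt.2 fun t ↦ (hJd t).continuousAt
  have hzc : Continuous z := by
    rw [show z = fun t ↦ b t - (integratingFactor a t)⁻¹ * J t from funext hz]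
    exact hb.sub ((hc.inv₀ fun t ↦ (integratingFactor_pos a t).ne').mul hJcont)
  have hd : ∀ t ∈ uIcc 0 T, HasDerivAt (fun t ↦ -((integratingFactor a t)⁻¹ * J t))
      (a t * z t) t := by
    intro t _
    have hpos := (integratingFactor_pos a t).ne'
    have := (((hasDerivAt_integratingFactor ha t).inv hpos).mul (hJd t)).neg
    refine this.congr_deriv ?_
    rw [hz t, Pi.inv_apply]
    field_simp
    ring
  have hint := intervalIntegral.integral_eq_sub_of_hasDerivAt hd
    (Continuous.intervalIntegrable (by fun_prop) _ _)
  rw [hint, hz T]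
  simp [hJ, add_comm]

end LinearEquation

/-! ### The linear stochastic equation -/

/-- The coefficient `1 - 3 m² - 3 σ² V` of the linear equation, extended to negative times. -/
noncomputable def linCoeff (σ : ℝ) (m V : ℝ → ℝ) (t : ℝ) : ℝ :=
  1 - 3 * m (max t 0) ^ 2 - 3 * σ ^ 2 * V (max t 0)

lemma linCoeff_of_nonneg (σ : ℝ) (m V : ℝ → ℝ) {t : ℝ} (ht : 0 ≤ t) :
    linCoeff σ m V t = 1 - 3 * m t ^ 2 - 3 * σ ^ 2 * V t := by
  rw [linCoeff, max_eq_left ht]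

lemma continuous_linCoeff (σ : ℝ) {m V : ℝ → ℝ} (hm : ContinuousOn m (Ici 0))
    (hV : ContinuousOn V (Ici 0)) : Continuous (linCoeff σ m V) := by
  have h : Continuous fun t : ℝ ↦ max t 0 := by fun_prop
  have h1 : Continuous fun t : ℝ ↦ m (max t 0) := hm.comp_continuous h fun t ↦ mem_Ici.2 (le_max_right _ _)
  have h2 : Continuous fun t : ℝ ↦ V (max t 0) := hV.comp_continuous h fun t ↦ mem_Ici.2 (le_max_right _ _)
  unfold linCoeff
  exact (continuous_const.sub (continuous_const.mul (h1.pow 2))).sub (continuous_const.mul h2)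

section

variable {Ω : Type*} [MeasurableSpace Ω] {P : Measure Ω} {B : ℝ≥0 → Ω → ℝ} {σ : ℝ} {m V : ℝ → ℝ}

/-- The Wiener integral `∫₀ᵗ exp(-∫₀ᵘ a) dB(u)`. -/
noncomputable abbrev linWiener (σ : ℝ) (m V : ℝ → ℝ) (B : ℝ≥0 → Ω → ℝ) : ℝ≥0 → Ω → ℝ :=
  wienerIntegral (integratingFactor (linCoeff σ m V))
    (fun t ↦ -linCoeff σ m V t * integratingFactor (linCoeff σ m V) t) B

/-- The σ-algebra is left free so that it can be the past of `B`; this gives adaptedness of the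
solution. `limUnder` is measurable whether or not the sums converge. -/
lemma measurable_limUnder_wienerSum {Ω : Type*} {mΩ : MeasurableSpace Ω} {B : ℝ≥0 → Ω → ℝ}
    {t : ℝ≥0} (ψ : ℝ → ℝ) (c : ℝ) (hB : ∀ r ≤ t, Measurable (B r)) :
    Measurable fun ω ↦ c * Filter.limUnder Filter.atTop (wienerSum ψ B 0 t · ω) := by
  refine Measurable.const_mul (StronglyMeasurable.measurable ?_) _
  refine StronglyMeasurable.limUnder fun n ↦ Measurable.stronglyMeasurable ?_
  unfold wienerSum
  refine Finset.measurable_fun_sum _ fun i hi ↦ ?_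
  have hle : ∀ j, j ≤ n + 1 → gridPt 0 t n j ≤ t := fun j hj ↦
    (gridPt_mono 0 t n hj).trans (by rw [gridPt_last, zero_add])
  have hi' : i + 1 ≤ n + 1 := Finset.mem_range.1 hi
  exact ((hB _ (hle _ hi')).sub (hB _ (hle _ (by omega)))).const_mul _

/-- The solution is built from limits of Riemann sums because these are measurable for the past of
`B`. Almost surely they agree with the pathwise Wiener integral, for which variation of constants
solves the equation. -/
lemma exists_isLinearSolution [IsProbabilityMeasure P] (hm : ContinuousOn m (Ici 0))
    (hV : ContinuousOn V (Ici 0)) (hBm : ∀ t, Measurable (B t)) (hB : IsBrownianReal B P) :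
    ∃ z : ℝ≥0 → Ω → ℝ, IsLinearSolution σ m V P B z := by
  have ha := continuous_linCoeff σ hm hV
  set a := linCoeff σ m V with hadef
  have hψ := hasDerivAt_integratingFactor ha
  have hψc := continuous_integratingFactor ha
  have hψ' : Continuous fun t ↦ -a t * integratingFactor a t := by fun_prop
  set z : ℝ≥0 → Ω → ℝ := fun t ω ↦ (integratingFactor a t)⁻¹ *
    Filter.limUnder Filter.atTop (wienerSum (integratingFactor a) B 0 t · ω) with hz
  have hpast : ∀ t, Measurable[pastSigma B t] (z t) := by
    intro t
    have hBt : ∀ r ≤ t, Measurable[pastSigma B t] (B r) := fun r hr ↦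
      (comap_measurable (B r)).mono (le_iSup₂_of_le r hr le_rfl) le_rfl
    exact measurable_limUnder_wienerSum (mΩ := pastSigma B t) _ _ hBt
  have hpath : ∀ᵐ ω ∂P, Continuous (B · ω) ∧ ∀ t : ℝ≥0,
      integratingFactor a t * z t ω = linWiener σ m V B t ω := by
    filter_upwards [hB.cont, wienerIntegral_zero hB.toIsPreBrownianReal (integratingFactor a)
      fun t ↦ -a t * integratingFactor a t] with ω h1 h2
    refine ⟨h1, fun t ↦ ?_⟩
    have h3 := tendsto_wienerSum hψ hψ' h1 0 t
    rw [zero_add, h2, sub_zero] at h3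
    simp only [hz]
    rw [h3.limUnder_eq, mul_inv_cancel_left₀ (integratingFactor_pos a _).ne']
  have hpath2 : ∀ᵐ ω ∂P, ∃ b w : ℝ → ℝ, Continuous b ∧ Continuous w ∧
      (∀ t : ℝ≥0, b t = B t ω ∧ w t = z t ω) ∧
      ∀ t, w t = (∫ u in (0 : ℝ)..t, a u * w u) + b t := by
    filter_upwards [hpath] with ω ⟨h1, h2⟩
    have hb : Continuous fun u : ℝ ↦ B u.toNNReal ω := h1.comp continuous_real_toNNReal
    set J : ℝ → ℝ := fun t ↦ ∫ u in (0 : ℝ)..t, -a u * integratingFactor a u * B u.toNNReal ω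
    have hJ : Continuous J := intervalIntegral.continuous_primitive
      (fun _ _ ↦ (hψ'.mul hb).intervalIntegrable _ _) 0
    set w : ℝ → ℝ := fun t ↦ (integratingFactor a t)⁻¹ *
      (integratingFactor a t * B t.toNNReal ω - J t) with hw
    have hwc : Continuous w := (hψc.inv₀ fun t ↦ (integratingFactor_pos a t).ne').mul
      ((hψc.mul hb).sub hJ)
    refine ⟨_, w, hb, hwc, fun t ↦ ⟨by simp, ?_⟩, ?_⟩
    · have := h2 t
      simp only [hw]
      rw [inv_mul_eq_iff_eq_mul₀ (integratingFactor_pos a _).ne', this]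
      simp [wienerIntegral, J, hadef]
    · refine solves_of_variation_of_constants ha hb fun t ↦ ?_
      simp only [hw]
      rw [mul_inv_cancel_left₀ (integratingFactor_pos a _).ne']
  have hle : ∀ t, pastSigma B t ≤ (inferInstance : MeasurableSpace Ω) := fun t ↦
    iSup₂_le fun r _ ↦ (hBm r).comap_le
  refine ⟨z, fun t ↦ (hpast t).mono (hle t) le_rfl,
    fun t ↦ (hpast t).stronglyMeasurable.aestronglyMeasurable, ?_, ?_, ?_⟩
  · filter_upwards [hpath2] with ω ⟨b, w, hb, hw, hbw, h⟩
    simp only [← fun t ↦ (hbw t).2]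
    fun_prop
  · filter_upwards [hpath2] with ω ⟨b, w, hb, hw, hbw, h⟩ t
    refine ((ha.mul hw).intervalIntegrable 0 t).congr fun u hu ↦ ?_
    rw [uIoc_of_le t.coe_nonneg] at hu
    rw [Pi.mul_apply, hadef, linCoeff_of_nonneg _ _ _ hu.1.le, ← (hbw _).2, Real.coe_toNNReal _ hu.1.le]
  · filter_upwards [hpath2] with ω ⟨b, w, hb, hw, hbw, h⟩ t
    rw [← (hbw t).2, ← (hbw t).1, h t, zero_add, one_mul]
    congr 1
    refine intervalIntegral.integral_congr fun u hu ↦ ?_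
    rw [uIcc_of_le t.coe_nonneg] at hu
    rw [hadef, linCoeff_of_nonneg _ _ _ hu.1, ← (hbw _).2, Real.coe_toNNReal _ hu.1]

/-- Every solution of the linear equation is given by variation of constants. -/
lemma IsLinearSolution.ae_eq {z : ℝ≥0 → Ω → ℝ} (hz : IsLinearSolution σ m V P B z)
    (hm : ContinuousOn m (Ici 0)) (hV : ContinuousOn V (Ici 0)) (hB : IsBrownianReal B P) :
    ∀ᵐ ω ∂P, ∀ t : ℝ≥0,
      z t ω = (integratingFactor (linCoeff σ m V) t)⁻¹ * linWiener σ m V B t ω := by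
  have ha := continuous_linCoeff σ hm hV
  filter_upwards [hz.continuous_paths, hz.integral_eq, hB.cont] with ω h1 h2 h3 t
  have := variation_of_constants ha (b := fun u ↦ B u.toNNReal ω) (z := fun u ↦ z u.toNNReal ω)
    (h3.comp continuous_real_toNNReal) (h1.comp continuous_real_toNNReal) t.2 (by
      intro s hs
      have h4 := h2 s.toNNReal
      rw [Real.coe_toNNReal _ hs.1, zero_add, one_mul] at h4
      rw [h4]
      congr 1
      refine intervalIntegral.integral_congr fun u hu ↦ ?_
      rw [uIcc_of_le hs.1] at hu
      rw [linCoeff_of_nonneg _ _ _ hu.1])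
  rw [eq_inv_mul_iff_mul_eq₀ (integratingFactor_pos _ _).ne']
  simpa [wienerIntegral] using this

end

section

variable {Ω : Type*} [MeasurableSpace Ω] {P : Measure Ω} {B z : ℝ≥0 → Ω → ℝ}
  {α θ σ x₀ μ₀ : ℝ} {m ν V : ℝ → ℝ}

/-- `V` is the variance of the linear equation. -/
lemma IsAuxSolution.V_eq (h : IsAuxSolution α θ σ x₀ μ₀ m ν V) {t : ℝ} (ht : 0 ≤ t) :
    integratingFactor (linCoeff σ m V) t ^ 2 * V t =
      ∫ u in (0 : ℝ)..t, integratingFactor (linCoeff σ m V) u ^ 2 := by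
  have ha := continuous_linCoeff σ h.continuousOn_m h.continuousOn_V
  have hc := continuous_integratingFactor ha
  have hd : ∀ u, 0 ≤ u → HasDerivWithinAt
      (fun u ↦ integratingFactor (linCoeff σ m V) u ^ 2 * V u)
      (integratingFactor (linCoeff σ m V) u ^ 2) (Ici 0) u := by
    intro u hu
    -- With `ψ` the integrating factor, `(ψ²V)' = ψ²(V' - 2aV) = ψ²`.
    refine ((((hasDerivAt_integratingFactor ha u).hasDerivWithinAt).fun_pow 2).fun_mul
      (h.V_deriv u hu)).congr_deriv ?_
    rw [linCoeff_of_nonneg _ _ _ hu]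
    push_cast
    ring
  rw [intervalIntegral.integral_eq_sub_of_hasDeriv_right_of_le ht
    (f := fun u ↦ integratingFactor (linCoeff σ m V) u ^ 2 * V u)
    (fun u hu ↦ (hd u hu.1).continuousWithinAt.mono Icc_subset_Ici_self)
    (fun u hu ↦ (hd u hu.1.le).mono fun v hv ↦ hu.1.le.trans (le_of_lt hv))
    (Continuous.intervalIntegrable (by fun_prop) _ _)]
  simp [h.V_zero]

lemma IsLinearSolution.isGaussianProcess (hz : IsLinearSolution σ m V P B z)
    (hm : ContinuousOn m (Ici 0)) (hV : ContinuousOn V (Ici 0)) (hB : IsBrownianReal B P) :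
    IsGaussianProcess z P := by
  have ha := continuous_linCoeff σ hm hV
  have hc := continuous_integratingFactor ha
  have := (wienerIntegral_isGaussianProcess hB (hasDerivAt_integratingFactor ha)
    (by fun_prop)).smul fun t : ℝ≥0 ↦ (integratingFactor (linCoeff σ m V) t)⁻¹
  refine this.congr fun t ↦ ?_
  filter_upwards [hz.ae_eq hm hV hB] with ω hω
  rw [hω t, smul_eq_mul]

lemma IsLinearSolution.hasLaw (hz : IsLinearSolution σ m V P B z)
    (h : IsAuxSolution α θ σ x₀ μ₀ m ν V) (hB : IsBrownianReal B P) (t : ℝ≥0) :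
    HasLaw (z t) (gaussianReal 0 (V t).toNNReal) P := by
  have ha := continuous_linCoeff σ h.continuousOn_m h.continuousOn_V
  have hc := continuous_integratingFactor ha
  have h1 := wienerIntegral_hasLaw hB (hasDerivAt_integratingFactor ha) (by fun_prop) t
  rw [← h.V_eq t.coe_nonneg] at h1
  have h2 := gaussianReal_const_mul h1 (integratingFactor (linCoeff σ m V) t)⁻¹
  have hpos := integratingFactor_pos (linCoeff σ m V) t
  convert h2.congr (Y := z t) ?_ using 2
  · simp
  · refine NNReal.coe_injective ?_
    rw [Real.toNNReal_mul (sq_nonneg _), Real.toNNReal_of_nonneg (sq_nonneg _)]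
    push_cast
    rw [inv_pow]
    field_simp
  · filter_upwards [hz.ae_eq h.continuousOn_m h.continuousOn_V hB] with ω hω
    rw [hω t]

lemma gaussApprox_isGaussianProcess (hz : IsLinearSolution σ m V P B z)
    (h : IsAuxSolution α θ σ x₀ μ₀ m ν V) (hB : IsBrownianReal B P) :
    IsGaussianProcess (gaussApprox σ m z) P :=
  isGaussianProcess_const_add ((hz.isGaussianProcess h.continuousOn_m h.continuousOn_V hB).smul
    fun _ ↦ σ) fun t ↦ m t

/-- By orthogonality of increments, the covariance at times `r ≤ u` depends on `u` only through the
factor `ψ(u)⁻¹`. Replacing `s` by `t` therefore multiplies it by `ψ(t)⁻¹ψ(s)`. -/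
lemma gaussApprox_isMarkovReal [IsProbabilityMeasure P] (hz : IsLinearSolution σ m V P B z)
    (h : IsAuxSolution α θ σ x₀ μ₀ m ν V) (hB : IsBrownianReal B P) :
    IsMarkovReal (gaussApprox σ m z) P := by
  have ha := continuous_linCoeff σ h.continuousOn_m h.continuousOn_V
  have hc := continuous_integratingFactor ha
  have hψ' : Continuous fun t ↦ -linCoeff σ m V t * integratingFactor (linCoeff σ m V) t := by
    fun_prop
  set ψ := integratingFactor (linCoeff σ m V) with hψ
  refine isMarkovReal_of_covariance
    (fun t ↦ ((hz.measurable t).const_mul σ).const_add _)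
    (gaussApprox_isGaussianProcess hz h hB) fun s t hst ↦ ⟨(ψ t)⁻¹ * ψ s, fun r hr ↦ ?_⟩
  have hcov : ∀ r u : ℝ≥0, r ≤ u → cov[gaussApprox σ m z r, gaussApprox σ m z u; P] =
      σ ^ 2 * (ψ r)⁻¹ * (ψ u)⁻¹ * Var[linWiener σ m V B r; P] := by
    intro r u hru
    have hG := hz.isGaussianProcess h.continuousOn_m h.continuousOn_V hB
    have hi := fun t ↦ (hG.hasGaussianLaw_eval t).integrable
    rw [← covariance_wienerIntegral hB (hasDerivAt_integratingFactor ha) hψ' hru]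
    unfold gaussApprox
    rw [covariance_const_add_left ((hi _).const_mul σ), covariance_const_add_right
      ((hi _).const_mul σ), covariance_const_mul_left, covariance_const_mul_right]
    have e : ∀ t, z t =ᵐ[P] fun ω ↦ (ψ t)⁻¹ * linWiener σ m V B t ω := fun t ↦ by
      filter_upwards [hz.ae_eq h.continuousOn_m h.continuousOn_V hB] with ω hω using hω t
    have : cov[z r, z u; P] = (ψ r)⁻¹ * ((ψ u)⁻¹ *
        cov[linWiener σ m V B r, linWiener σ m V B u; P]) := by
      rw [← covariance_const_mul_right, ← covariance_const_mul_left]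
      simp only [covariance, integral_congr_ae (e r), integral_congr_ae (e u)]
      refine integral_congr_ae ?_
      filter_upwards [e r, e u] with ω h1 h2
      rw [h1, h2]
    change σ * (σ * cov[z r, z u; P]) = _
    rw [this]
    ring
  rw [hcov r t (hr.trans hst), hcov r s hr]
  have : ψ s ≠ 0 := (integratingFactor_pos (linCoeff σ m V) s).ne'
  field_simp

lemma gaussApprox_zero (hz : IsLinearSolution σ m V P B z)
    (h : IsAuxSolution α θ σ x₀ μ₀ m ν V) (hB : IsBrownianReal B P) :
    ∀ᵐ ω ∂P, gaussApprox σ m z 0 ω = x₀ := by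
  filter_upwards [hz.integral_eq, hB.eval_zero_ae_eq_zero] with ω h1 h2
  simp [gaussApprox, h1 0, h2, h.m_zero]

end

/-! ### Moments of the Gaussian approximation -/

section

variable {Ω : Type*} [MeasurableSpace Ω] {P : Measure Ω}

lemma integrable_pow_of_hasLaw_gaussianReal {X : Ω → ℝ} {μ : ℝ} {v : ℝ≥0}
    (hX : HasLaw X (gaussianReal μ v) P) (k : ℕ) : Integrable (fun ω ↦ X ω ^ k) P := by
  have h1 : Integrable (fun x : ℝ ↦ ‖id x‖ ^ k) (gaussianReal μ v) :=
    MemLp.integrable_norm_pow' (by simpa using memLp_id_gaussianReal (μ := μ) (v := v) k)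
  have h2 : Integrable (fun x : ℝ ↦ x ^ k) (P.map X) := by
    rw [hX.map_eq]
    refine (integrable_norm_iff (by fun_prop)).1 ?_
    simpa using h1
  exact h2.comp_aemeasurable hX.aemeasurable

lemma integral_quartic [IsProbabilityMeasure P] {X : Ω → ℝ} {v : ℝ≥0}
    (hX : HasLaw X (gaussianReal 0 v) P) (c₀ c₁ c₂ c₃ c₄ : ℝ) :
    ∫ ω, (c₀ + c₁ * X ω + c₂ * X ω ^ 2 + c₃ * X ω ^ 3 + c₄ * X ω ^ 4) ∂P =
      c₀ + c₂ * v + 3 * c₄ * (v : ℝ) ^ 2 := by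
  obtain ⟨m1, m2, m3, m4⟩ := gaussianReal_moments hX
  have hi := integrable_pow_of_hasLaw_gaussianReal hX
  have i1 : Integrable X P := by simpa using hi 1
  have a1 : Integrable (fun ω ↦ c₀ + c₁ * X ω) P := (integrable_const _).add (i1.const_mul _)
  have a2 : Integrable (fun ω ↦ c₀ + c₁ * X ω + c₂ * X ω ^ 2) P := a1.add ((hi 2).const_mul _)
  have a3 : Integrable (fun ω ↦ c₀ + c₁ * X ω + c₂ * X ω ^ 2 + c₃ * X ω ^ 3) P :=
    a2.add ((hi 3).const_mul _)
  rw [integral_add a3 ((hi 4).const_mul _), integral_add a2 ((hi 3).const_mul _),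
    integral_add a1 ((hi 2).const_mul _), integral_add (integrable_const _) (i1.const_mul _)]
  simp only [integral_const_mul, m1, m2, m3, m4, integral_const, probReal_univ, smul_eq_mul]
  ring

lemma integrable_gaussApprox_pow {B z : ℝ≥0 → Ω → ℝ} {α θ σ x₀ μ₀ : ℝ} {m ν V : ℝ → ℝ}
    (hz : IsLinearSolution σ m V P B z)
    (h : IsAuxSolution α θ σ x₀ μ₀ m ν V) (hB : IsBrownianReal B P) (j : ℕ) (t : ℝ≥0) :
    Integrable (fun ω ↦ gaussApprox σ m z t ω ^ j) P := by
  have hG := (gaussApprox_isGaussianProcess hz h hB).hasGaussianLaw_eval t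
  exact integrable_pow_of_hasLaw_gaussianReal ⟨hG.aemeasurable, hG.map_eq_gaussianReal⟩ j

variable [IsProbabilityMeasure P] {B z : ℝ≥0 → Ω → ℝ} {α θ σ x₀ μ₀ : ℝ} {m ν V : ℝ → ℝ}

lemma moment_at_gaussApprox (hz : IsLinearSolution σ m V P B z)
    (h : IsAuxSolution α θ σ x₀ μ₀ m ν V) (hB : IsBrownianReal B P)
    (hVt : ∀ t, 0 ≤ t → 0 ≤ V t) {t : ℝ} (ht : 0 ≤ t) :
    moment_at P (gaussApprox σ m z) 0 t = 1 ∧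
    moment_at P (gaussApprox σ m z) 1 t = m t ∧
    moment_at P (gaussApprox σ m z) 2 t = m t ^ 2 + σ ^ 2 * V t ∧
    moment_at P (gaussApprox σ m z) 3 t = m t ^ 3 + 3 * m t * (σ ^ 2 * V t) ∧
    moment_at P (gaussApprox σ m z) 4 t =
      m t ^ 4 + 6 * m t ^ 2 * (σ ^ 2 * V t) + 3 * (σ ^ 2 * V t) ^ 2 := by
  have key := integral_quartic (hz.hasLaw h hB t.toNNReal)
  rw [Real.coe_toNNReal t ht, Real.coe_toNNReal _ (hVt t ht)] at key
  simp only [moment_at, gaussApprox, Real.coe_toNNReal t ht]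
  refine ⟨by simp, ?_, ?_, ?_, ?_⟩
  · have := key (m t) σ 0 0 0
    ring_nf at this ⊢
    exact this
  · have := key (m t ^ 2) (2 * m t * σ) (σ ^ 2) 0 0
    ring_nf at this ⊢
    exact this
  · have := key (m t ^ 3) (3 * m t ^ 2 * σ) (3 * m t * σ ^ 2) (σ ^ 3) 0
    ring_nf at this ⊢
    exact this
  · have := key (m t ^ 4) (4 * m t ^ 3 * σ) (6 * m t ^ 2 * σ ^ 2) (4 * m t * σ ^ 3) (σ ^ 4)
    ring_nf at this ⊢
    exact this

/-- The Gaussian values of `M₃` and `M₄` close the hierarchy: the equations for `k = 1, 2` become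
those for the derivatives of `m` and `m² + σ²V`. -/
lemma satisfiesMomentEquations (hz : IsLinearSolution σ m V P B z)
    (h : IsAuxSolution α θ σ x₀ μ₀ m ν V) (hB : IsBrownianReal B P)
    (hVt : ∀ t, 0 ≤ t → 0 ≤ V t) :
    SatisfiesMomentEquations α θ σ P (gaussApprox σ m z) ν 1 ∧
      SatisfiesMomentEquations α θ σ P (gaussApprox σ m z) ν 2 := by
  have M := fun {t : ℝ} (ht : 0 ≤ t) ↦ moment_at_gaussApprox hz h hB hVt ht
  have d1 : ∀ t, 0 ≤ t → HasDerivWithinAt (moment_at P (gaussApprox σ m z) 1)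
      (auxMeanDrift σ (m t) (ν t) (V t)) (Ici 0) t := fun t ht ↦
    (h.m_deriv t ht).congr (fun s hs ↦ (M hs).2.1) (M ht).2.1
  have d2 : ∀ t, 0 ≤ t → HasDerivWithinAt (moment_at P (gaussApprox σ m z) 2)
      (2 * m t * auxMeanDrift σ (m t) (ν t) (V t) +
        σ ^ 2 * (1 + 2 * (1 - 3 * m t ^ 2) * V t - 6 * σ ^ 2 * V t ^ 2)) (Ici 0) t := by
    intro t ht
    have := ((h.m_deriv t ht).fun_pow 2).fun_add ((h.V_deriv t ht).const_mul (σ ^ 2))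
    refine (this.congr (fun s hs ↦ (M hs).2.2.1) (M ht).2.2.1).congr_deriv ?_
    push_cast
    ring
  have d3 : ∀ t, 0 ≤ t → HasDerivWithinAt ν (-(α - θ) * ν t -
      θ * (-moment_at P (gaussApprox σ m z) 3 t + moment_at P (gaussApprox σ m z) 1 t))
      (Ici 0) t := by
    intro t ht
    refine (h.ν_deriv t ht).congr_deriv ?_
    obtain ⟨-, m1, -, m3, -⟩ := M ht
    rw [m1, m3, auxMeanDrift]
    ring
  have d4 : ∀ t, 0 ≤ t → HasDerivWithinAt ν
      (-α * ν t - θ * derivWithin (moment_at P (gaussApprox σ m z) 1) (Ici 0) t) (Ici 0) t := by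
    intro t ht
    rw [(d1 t ht).derivWithin (uniqueDiffOn_Ici 0 t ht)]
    exact h.ν_deriv t ht
  refine ⟨⟨fun j _ t ↦ integrable_gaussApprox_pow hz h hB j t, fun t ht ↦ ?_, d3, d4⟩,
    ⟨fun j _ t ↦ integrable_gaussApprox_pow hz h hB j t, fun t ht ↦ ?_, d3, d4⟩⟩
  · refine (d1 t ht).congr_deriv ?_
    obtain ⟨m0, m1, -, m3, -⟩ := M ht
    simp only [Nat.reduceAdd, Nat.cast_one, sub_self, mul_zero, zero_mul, m0, m1, m3, auxMeanDrift]
    ring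
  · refine (d2 t ht).congr_deriv ?_
    obtain ⟨m0, m1, m2, -, m4⟩ := M ht
    simp only [Nat.reduceAdd, Nat.reduceSub, Nat.cast_ofNat, m0, m1, m2, m4, auxMeanDrift]
    ring

end

/-! ### Pathwise estimates for the difference of two dissipative equations -/

section Path

variable {x y r : ℝ → ℝ} {T : ℝ}

/-- The difference has a continuous derivative even where `x` and `y` are rough, because the common
noise is absent from the integral equation. -/
lemma hasDerivWithinAt_sub_of_integral_eq (hx : ContinuousOn x (Icc 0 T))
    (hy : ContinuousOn y (Icc 0 T)) (hr : ContinuousOn r (Icc 0 T))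
    (h : ∀ t ∈ Icc 0 T, x t - y t =
      ∫ s in (0 : ℝ)..t, (-(x s ^ 3 - y s ^ 3) + (x s - y s) - r s)) :
    ∀ t ∈ Icc 0 T, HasDerivWithinAt (fun t ↦ x t - y t)
      (-(x t ^ 3 - y t ^ 3) + (x t - y t) - r t) (Icc 0 T) t := fun t ht ↦
  (hasDerivWithinAt_integral_Icc (g := fun s ↦ -(x s ^ 3 - y s ^ 3) + (x s - y s) - r s)
    (by fun_prop) ht).congr h (h t ht)

lemma cube_sub_cube_mul_nonneg (a b : ℝ) : 0 ≤ (a ^ 3 - b ^ 3) * (a - b) := by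
  nlinarith [mul_nonneg (sq_nonneg (a - b)) (sq_nonneg (a + b)), sq_nonneg ((a - b) * a),
    sq_nonneg ((a - b) * b)]

/-- The monotone cubic term does not contribute to the growth of the difference. -/
lemma abs_sub_le_exp_mul_integral (hx : ContinuousOn x (Icc 0 T))
    (hy : ContinuousOn y (Icc 0 T)) (hr : ContinuousOn r (Icc 0 T))
    (h : ∀ t ∈ Icc 0 T, x t - y t =
      ∫ s in (0 : ℝ)..t, (-(x s ^ 3 - y s ^ 3) + (x s - y s) - r s)) :
    ∀ t ∈ Icc 0 T, |x t - y t| ≤ Real.exp t * ∫ s in (0 : ℝ)..t, |r s| := by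
  intro t ht
  have hd := hasDerivWithinAt_sub_of_integral_eq hx hy hr h
  have h0 : x 0 - y 0 = 0 := by
    simpa using h 0 ⟨le_rfl, ht.1.trans ht.2⟩
  have h1 := le_exp_mul_integral (c := 1) zero_le_one hd h0.le (h := fun s ↦ |r s|) hr.abs
    (fun _ _ ↦ abs_nonneg _) (fun t _ hpos ↦ by
      have := nonneg_of_mul_nonneg_left (cube_sub_cube_mul_nonneg (x t) (y t)) hpos
      linarith [neg_abs_le (r t)]) t ht
  have h2 := le_exp_mul_integral (c := 1) zero_le_one (fun t ht ↦ (hd t ht).fun_neg)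
    (by simp [h0]) (h := fun s ↦ |r s|) hr.abs
    (fun _ _ ↦ abs_nonneg _) (fun t _ hpos ↦ by
      have h3 := cube_sub_cube_mul_nonneg (x t) (y t)
      have := nonneg_of_mul_nonneg_left (a := -(x t ^ 3 - y t ^ 3)) (by linarith) hpos
      linarith [le_abs_self (r t)]) t ht
  rw [one_mul] at h1 h2
  exact abs_le.2 ⟨by linarith, h1⟩

/-- For `|a - b| ≤ 1` the left side is at most `3 + 5b²` by factoring. For `|a - b| ≥ 1` one has
`√(1 + (a - b)²) ≤ 2|a - b|`, and the first term suffices. That term is the one dissipated by the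
energy `√(1 + D²)`. -/
lemma abs_cube_sub_cube_le (a b : ℝ) :
    |a ^ 3 - b ^ 3| ≤ 2 * ((a ^ 3 - b ^ 3) * (a - b) / √(1 + (a - b) ^ 2)) +
      (3 + 5 * b ^ 2) := by
  have hs : 0 < √(1 + (a - b) ^ 2) := Real.sqrt_pos.2 (by positivity)
  have hκ := cube_sub_cube_mul_nonneg a b
  have hnn : 0 ≤ (a ^ 3 - b ^ 3) * (a - b) / √(1 + (a - b) ^ 2) := by positivity
  rcases le_total |a - b| 1 with hD | hD
  · have h1 : |a ^ 3 - b ^ 3| ≤ 3 + 5 * b ^ 2 := by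
      have e : a ^ 3 - b ^ 3 = (a - b) * ((a - b) ^ 2 + 3 * (a - b) * b + 3 * b ^ 2) := by ring
      have h2 : |(a - b) ^ 2 + 3 * (a - b) * b + 3 * b ^ 2| ≤ 3 + 5 * b ^ 2 := by
        obtain ⟨h3, h4⟩ := abs_le.1 hD
        rw [abs_le]
        constructor <;> nlinarith [sq_nonneg (a - b + b), sq_nonneg (a - b - b)]
      rw [e, abs_mul]
      calc |a - b| * |(a - b) ^ 2 + 3 * (a - b) * b + 3 * b ^ 2|
          ≤ 1 * (3 + 5 * b ^ 2) := by gcongr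
        _ = _ := one_mul _
    linarith
  · have h1 : √(1 + (a - b) ^ 2) ≤ 2 * |a - b| := by
      rw [Real.sqrt_le_left (by positivity), mul_pow, sq_abs]
      nlinarith [sq_abs (a - b)]
    have h2 : |a ^ 3 - b ^ 3| ≤ 2 * ((a ^ 3 - b ^ 3) * (a - b) / √(1 + (a - b) ^ 2)) := by
      rw [mul_div_assoc', le_div_iff₀ hs, ← abs_of_nonneg hκ, abs_mul]
      nlinarith [abs_nonneg (a ^ 3 - b ^ 3)]
    nlinarith [sq_nonneg b]

/-- With `D = x - y`, the energy `√(1 + D²)` starts at its minimum `1`, so its total change is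
nonnegative and the dissipation by the cubic is at most `∫(|D| + |r|)`. Only the square of `y`
enters the rest, and no moment of `x`. -/
lemma integral_abs_cube_sub_cube_le (hT : 0 ≤ T) (hx : ContinuousOn x (Icc 0 T))
    (hy : ContinuousOn y (Icc 0 T)) (hr : ContinuousOn r (Icc 0 T))
    (h : ∀ t ∈ Icc 0 T, x t - y t =
      ∫ s in (0 : ℝ)..t, (-(x s ^ 3 - y s ^ 3) + (x s - y s) - r s)) :
    ∫ s in (0 : ℝ)..T, |x s ^ 3 - y s ^ 3| ≤
      2 * (∫ s in (0 : ℝ)..T, (|x s - y s| + |r s|)) + ∫ s in (0 : ℝ)..T, (3 + 5 * y s ^ 2) := by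
  have hI : ∀ {f : ℝ → ℝ}, ContinuousOn f (Icc 0 T) → IntervalIntegrable f volume 0 T :=
    fun hf ↦ (hf.mono (by rw [uIcc_of_le hT])).intervalIntegrable
  have hd := hasDerivWithinAt_sub_of_integral_eq hx hy hr h
  have hs : ∀ s, 0 < 1 + (x s - y s) ^ 2 := fun s ↦ by positivity
  have hsq : ContinuousOn (fun s ↦ √(1 + (x s - y s) ^ 2)) (Icc 0 T) := by fun_prop
  have hsne : ∀ s ∈ Icc 0 T, √(1 + (x s - y s) ^ 2) ≠ 0 := fun s _ ↦ (Real.sqrt_pos.2 (hs s)).ne'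
  set φ' : ℝ → ℝ := fun s ↦ (x s - y s) * (-(x s ^ 3 - y s ^ 3) + (x s - y s) - r s) /
    √(1 + (x s - y s) ^ 2) with hφ'
  have hφc : ContinuousOn φ' (Icc 0 T) := ContinuousOn.div (by fun_prop) hsq hsne
  have hφd : ∀ t ∈ Icc 0 T, HasDerivWithinAt (fun s ↦ √(1 + (x s - y s) ^ 2)) (φ' t)
      (Icc 0 T) t := by
    intro t ht
    refine ((((hd t ht).fun_pow 2).const_add 1).sqrt (hs t).ne').congr_deriv ?_
    simp only [hφ']
    push_cast
    field_simp
  have hftc := intervalIntegral.integral_eq_sub_of_hasDeriv_right_of_le hT hsq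
    (fun t ht ↦ ((hφd t (Ioo_subset_Icc_self ht)).mono_of_mem_nhdsWithin
      (Icc_mem_nhdsGE_of_mem ⟨ht.1.le, ht.2⟩)).mono Ioi_subset_Ici_self) (hI hφc)
  have h0 : x 0 - y 0 = 0 := by simpa using h 0 ⟨le_rfl, hT⟩
  have hge : 0 ≤ ∫ s in (0 : ℝ)..T, φ' s := by
    rw [hftc, h0]
    have : 1 ≤ √(1 + (x T - y T) ^ 2) := by
      rw [Real.one_le_sqrt]; nlinarith [sq_nonneg (x T - y T)]
    simpa using this
  have hpt : ∀ s ∈ Icc 0 T, |x s ^ 3 - y s ^ 3| ≤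
      2 * (|x s - y s| + |r s|) + (3 + 5 * y s ^ 2) - 2 * φ' s := by
    intro s _
    have h1 := abs_cube_sub_cube_le (x s) (y s)
    have hp := Real.sqrt_pos.2 (hs s)
    have h2 : φ' s = -((x s ^ 3 - y s ^ 3) * (x s - y s) / √(1 + (x s - y s) ^ 2)) +
        (x s - y s) / √(1 + (x s - y s) ^ 2) * ((x s - y s) - r s) := by
      simp only [hφ']
      field_simp
      ring
    have h3 : |(x s - y s) / √(1 + (x s - y s) ^ 2)| ≤ 1 := by
      rw [abs_div, abs_of_pos hp, div_le_one hp, ← Real.sqrt_sq_eq_abs]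
      exact Real.sqrt_le_sqrt (by linarith)
    have h4 : (x s - y s) / √(1 + (x s - y s) ^ 2) * ((x s - y s) - r s) ≤
        |x s - y s| + |r s| := by
      refine (le_abs_self _).trans ?_
      rw [abs_mul]
      calc _ ≤ 1 * (|x s - y s| + |r s|) := by
            gcongr
            exact abs_sub _ _
        _ = _ := one_mul _
    linarith
  have i1 : IntervalIntegrable (fun s ↦ 2 * (|x s - y s| + |r s|)) volume 0 T := hI (by fun_prop)
  have i2 : IntervalIntegrable (fun s ↦ 3 + 5 * y s ^ 2) volume 0 T := hI (by fun_prop)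
  have hmono := intervalIntegral.integral_mono_on hT (hI (by fun_prop))
    ((i1.add i2).sub ((hI hφc).const_mul 2)) hpt
  rw [intervalIntegral.integral_sub (i1.add i2) ((hI hφc).const_mul 2),
    intervalIntegral.integral_add i1 i2, intervalIntegral.integral_const_mul,
    intervalIntegral.integral_const_mul] at hmono
  linarith

end Path

/-! ### Joint measurability and integrability of continuous processes -/

section Joint

variable {Ω : Type*} [MeasurableSpace Ω] {P : Measure Ω}

/-- Setting the process to zero on a measurable null set containing all discontinuous paths leaves
one continuous in time and measurable in `ω`, hence jointly measurable. -/
lemma aestronglyMeasurable_uncurry_of_continuous_paths [SFinite P] {X : ℝ≥0 → Ω → ℝ}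
    (hX : ∀ t, Measurable (X t)) (hc : ∀ᵐ ω ∂P, Continuous (X · ω)) (ρ : Measure ℝ) [SFinite ρ] :
    AEStronglyMeasurable (fun p : ℝ × Ω ↦ X p.1.toNNReal p.2) (ρ.prod P) := by
  set N := toMeasurable P {ω | ¬Continuous (X · ω)} with hN
  have hN0 : P N = 0 := by rw [hN, measure_toMeasurable]; exact hc
  have hNm : MeasurableSet N := measurableSet_toMeasurable _ _
  have hcN : ∀ ω, ω ∉ N → Continuous (X · ω) := fun ω hω ↦ by
    by_contra h
    exact hω (subset_toMeasurable _ _ h)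
  set X' : ℝ≥0 → Ω → ℝ := fun t ↦ Nᶜ.indicator (X t) with hX'
  have h1 : Measurable (Function.uncurry X') := by
    refine measurable_uncurry_of_continuous_of_measurable (fun ω ↦ ?_)
      fun t ↦ (hX t).indicator hNm.compl
    by_cases hω : ω ∈ N
    · simpa [hX', hω] using continuous_const
    · simpa [hX', hω] using hcN ω hω
  have h2 : Measurable fun p : ℝ × Ω ↦ X' p.1.toNNReal p.2 :=
    h1.comp ((continuous_real_toNNReal.measurable.comp measurable_fst).prodMk measurable_snd)
  refine h2.aestronglyMeasurable.congr ?_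
  have h3 : ∀ᵐ p ∂(ρ.prod P), p.2 ∉ N := by
    refine (Measure.quasiMeasurePreserving_snd (μ := ρ) (ν := P)).ae (p := fun ω ↦ ω ∉ N) ?_
    rw [ae_iff]; simpa using hN0
  filter_upwards [h3] with p hp
  simp [hX', hp]

lemma integrable_uncurry_of_integral_abs_le [IsProbabilityMeasure P] {f : ℝ × Ω → ℝ} {T C : ℝ}
    (hf : AEStronglyMeasurable f ((volume.restrict (Ioc 0 T)).prod P))
    (hi : ∀ u ∈ Ioc 0 T, Integrable (fun ω ↦ f (u, ω)) P)
    (hC : ∀ u ∈ Ioc 0 T, ∫ ω, |f (u, ω)| ∂P ≤ C) :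
    Integrable f ((volume.restrict (Ioc 0 T)).prod P) := by
  refine (integrable_prod_iff hf).2 ⟨?_, ?_⟩
  · exact (ae_restrict_mem measurableSet_Ioc).mono hi
  · refine Integrable.of_bound (C := C) hf.norm.integral_prod_right' ?_
    filter_upwards [ae_restrict_mem measurableSet_Ioc] with u hu
    rw [Real.norm_of_nonneg (integral_nonneg fun _ ↦ norm_nonneg _)]
    exact hC u hu

end Joint

/-! ### The error of the Gaussian closure -/

lemma integral_eq_sub_of_hasDerivWithinAt_Ici {f f' : ℝ → ℝ} {a t : ℝ}
    (hf : ∀ s, a ≤ s → HasDerivWithinAt f (f' s) (Ici a) s) (ht : a ≤ t)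
    (hi : IntervalIntegrable f' volume a t) : ∫ s in a..t, f' s = f t - f a :=
  intervalIntegral.integral_eq_sub_of_hasDeriv_right_of_le ht
    (fun s hs ↦ (hf s hs.1).continuousWithinAt.mono Icc_subset_Ici_self)
    (fun s hs ↦ (hf s hs.1.le).mono (Ioi_subset_Ici hs.1.le)) hi

/-- The part of the drift of `m + σ z` which deviates from that of the McKean–Vlasov equation. -/
def closureError (σ m V z : ℝ) : ℝ := 3 * m * σ ^ 2 * (z ^ 2 - V) + σ ^ 3 * (z ^ 3 - 3 * V * z)

/-- Odd powers are traded for even ones by `2|ab| ≤ a² + b²`, so the expectation of the bound is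
explicit. The zero terms give it the shape of `integral_quartic`. -/
lemma abs_closureError_le {σ m V A : ℝ} (hσ : 0 < σ) (hm : |m| ≤ A) (hV : 0 ≤ V) (z : ℝ) :
    |closureError σ m V z| ≤ (3 * A * σ ^ 2 * V + σ ^ 3 * (3 * V / 2)) + 0 * z +
      (3 * A * σ ^ 2 + σ ^ 3 * (1 / 2 + 3 * V / 2)) * z ^ 2 + 0 * z ^ 3 + σ ^ 3 / 2 * z ^ 4 := by
  have hA : 0 ≤ A := (abs_nonneg m).trans hm
  have h1 : |3 * m * σ ^ 2 * (z ^ 2 - V)| ≤ 3 * A * σ ^ 2 * (z ^ 2 + V) := by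
    rw [abs_mul, abs_mul, abs_mul, abs_of_pos (by positivity : (0 : ℝ) < 3),
      abs_of_nonneg (sq_nonneg σ)]
    have : |z ^ 2 - V| ≤ z ^ 2 + V := abs_le.2 ⟨by linarith [sq_nonneg z], by linarith⟩
    gcongr
  have h2 : |z ^ 3 - 3 * V * z| ≤ (z ^ 2 + z ^ 4) / 2 + 3 * V * ((1 + z ^ 2) / 2) := by
    have h3 : |z ^ 3| ≤ (z ^ 2 + z ^ 4) / 2 := abs_le.2
      ⟨by nlinarith [sq_nonneg (z + z ^ 2)], by nlinarith [sq_nonneg (z - z ^ 2)]⟩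
    have h4 : |z| ≤ (1 + z ^ 2) / 2 := abs_le.2
      ⟨by nlinarith [sq_nonneg (z + 1)], by nlinarith [sq_nonneg (z - 1)]⟩
    refine (abs_sub _ _).trans ?_
    rw [abs_mul (3 * V), abs_of_nonneg (by positivity : 0 ≤ 3 * V)]
    gcongr
  calc |closureError σ m V z| ≤ |3 * m * σ ^ 2 * (z ^ 2 - V)| + |σ ^ 3 * (z ^ 3 - 3 * V * z)| :=
        abs_add_le _ _
    _ ≤ 3 * A * σ ^ 2 * (z ^ 2 + V) + σ ^ 3 * ((z ^ 2 + z ^ 4) / 2 + 3 * V * ((1 + z ^ 2) / 2)) := by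
        rw [abs_mul (σ ^ 3), abs_of_pos (by positivity : 0 < σ ^ 3)]
        gcongr
    _ = _ := by ring

section

variable {Ω : Type*} [MeasurableSpace Ω] {P : Measure Ω} [IsProbabilityMeasure P]

lemma integrable_closureError {X : Ω → ℝ} {v : ℝ≥0} (hX : HasLaw X (gaussianReal 0 v) P)
    (σ m V : ℝ) : Integrable (fun ω ↦ closureError σ m V (X ω)) P := by
  have hi := integrable_pow_of_hasLaw_gaussianReal hX
  have i1 : Integrable X P := by simpa using hi 1
  exact ((((hi 2).sub (integrable_const V)).const_mul _).add
    (((hi 3).sub (i1.const_mul _)).const_mul _))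

/-- With `E z² = V` and `E z⁴ = 3V²`, the terms in `σ³` add up to `σ² · σV(2 + 3V)`. The bound on
`σV` is what yields order `σ²` for large `σ` too. -/
lemma integral_abs_closureError_le {X : Ω → ℝ} {σ m V A e : ℝ}
    (hX : HasLaw X (gaussianReal 0 V.toNNReal) P) (hσ : 0 < σ) (hm : |m| ≤ A) (hV : 0 ≤ V)
    (hVe : V ≤ e) (hσV : σ * V ≤ e) :
    ∫ ω, |closureError σ m V (X ω)| ∂P ≤ (6 * A * e + e * (2 + 3 * e)) * σ ^ 2 := by
  have hA : 0 ≤ A := (abs_nonneg m).trans hm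
  have he : 0 ≤ e := hV.trans hVe
  have hi := integrable_pow_of_hasLaw_gaussianReal hX
  have i1 : Integrable X P := by simpa using hi 1
  have h1 := integral_mono (integrable_closureError hX σ m V).abs
    (((((integrable_const _).add (i1.const_mul _)).add ((hi 2).const_mul _)).add
      ((hi 3).const_mul _)).add ((hi 4).const_mul _))
    (fun ω ↦ abs_closureError_le hσ hm hV (X ω))
  have h2 := integral_quartic hX (3 * A * σ ^ 2 * V + σ ^ 3 * (3 * V / 2)) 0
    (3 * A * σ ^ 2 + σ ^ 3 * (1 / 2 + 3 * V / 2)) 0 (σ ^ 3 / 2)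
  rw [Real.coe_toNNReal _ hV] at h2
  refine (h1.trans h2.le).trans ?_
  calc _ = σ ^ 2 * (6 * A * V) + σ ^ 2 * (σ * V * (2 + 3 * V)) := by ring
    _ ≤ σ ^ 2 * (6 * A * e) + σ ^ 2 * (e * (2 + 3 * e)) := by gcongr
    _ = _ := by ring

end

/-- The difference of the drifts of `x` and `m + σ z`, apart from `-u ^ 3 + u`. -/
def driftGap {Ω : Type*} (σ : ℝ) (m ν V μ : ℝ → ℝ) (z : ℝ≥0 → Ω → ℝ) (t : ℝ≥0) (ω : Ω) : ℝ :=
  μ t - ν t + closureError σ (m t) (V t) (z t ω)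

lemma continuous_coe_of_continuousOn {f : ℝ → ℝ} (hf : ContinuousOn f (Ici 0)) :
    Continuous fun t : ℝ≥0 ↦ f t := hf.comp_continuous NNReal.continuous_coe fun t ↦ t.2

lemma continuous_gaussApprox {Ω : Type*} {α θ σ x₀ μ₀ : ℝ} {m ν V : ℝ → ℝ}
    {z : ℝ≥0 → Ω → ℝ} (h : IsAuxSolution α θ σ x₀ μ₀ m ν V) {ω : Ω}
    (hz : Continuous (z · ω)) : Continuous (gaussApprox σ m z · ω) :=
  (continuous_coe_of_continuousOn h.continuousOn_m).add (continuous_const.mul hz)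

lemma continuous_driftGap {Ω : Type*} {α θ σ x₀ μ₀ : ℝ} {m ν V μ : ℝ → ℝ}
    {z : ℝ≥0 → Ω → ℝ} (h : IsAuxSolution α θ σ x₀ μ₀ m ν V)
    (hμ : ContinuousOn μ (Ici 0)) {ω : Ω} (hz : Continuous (z · ω)) :
    Continuous (driftGap σ m ν V μ z · ω) := by
  have h1 := continuous_coe_of_continuousOn h.continuousOn_m
  have h2 := continuous_coe_of_continuousOn h.continuousOn_ν
  have h3 := continuous_coe_of_continuousOn h.continuousOn_V
  have h4 := continuous_coe_of_continuousOn hμ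
  exact (h4.sub h2).add ((((continuous_const.mul h1).mul continuous_const).mul
    ((hz.pow 2).sub h3)).add (continuous_const.mul ((hz.pow 3).sub ((continuous_const.mul h3).mul hz))))

section

variable {Ω : Type*} [MeasurableSpace Ω] {P : Measure Ω} {α θ σ x₀ μ₀ : ℝ}
  {m ν V μ : ℝ → ℝ} {B x z : ℝ≥0 → Ω → ℝ}

lemma IsMcKeanVlasovSolution.continuousOn_μ (hx : IsMcKeanVlasovSolution α θ σ x₀ μ₀ P B x μ) :
    ContinuousOn μ (Ici 0) := fun t ht ↦ (hx.μ_deriv ⟨t, ht⟩).continuousWithinAt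

/-- The common noise cancels in the difference of the two processes. -/
lemma ae_sub_gaussApprox_eq (h : IsAuxSolution α θ σ x₀ μ₀ m ν V)
    (hz : IsLinearSolution σ m V P B z) (hx : IsMcKeanVlasovSolution α θ σ x₀ μ₀ P B x μ) :
    ∀ᵐ ω ∂P, Continuous (x · ω) ∧ Continuous (z · ω) ∧ ∀ t : ℝ, 0 ≤ t →
      x t.toNNReal ω - gaussApprox σ m z t.toNNReal ω = ∫ s in (0 : ℝ)..t,
        (-(x s.toNNReal ω ^ 3 - gaussApprox σ m z s.toNNReal ω ^ 3) +
          (x s.toNNReal ω - gaussApprox σ m z s.toNNReal ω) -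
          driftGap σ m ν V μ z s.toNNReal ω) := by
  filter_upwards [hx.sde.continuous_paths, hx.sde.drift_integrable, hx.sde.integral_eq,
    hz.continuous_paths, hz.drift_integrable, hz.integral_eq] with ω c1 d1 e1 c2 d2 e2
  refine ⟨c1, c2, fun t ht ↦ ?_⟩
  lift t to ℝ≥0 using ht
  have im : IntervalIntegrable (fun s ↦ auxMeanDrift σ (m s) (ν s) (V s)) volume 0 t := by
    have hc : ContinuousOn (fun s ↦ auxMeanDrift σ (m s) (ν s) (V s)) (Ici 0) := by
      have h1 := h.continuousOn_m
      have h2 := h.continuousOn_ν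
      have h3 := h.continuousOn_V
      unfold auxMeanDrift
      fun_prop
    exact (hc.mono (by rw [uIcc_of_le t.coe_nonneg]; exact Icc_subset_Ici_self)).intervalIntegrable
  have em := integral_eq_sub_of_hasDerivWithinAt_Ici h.m_deriv t.coe_nonneg im
  rw [Real.toNNReal_coe, gaussApprox, e1 t, e2 t]
  have hm : m t = x₀ + ∫ s in (0 : ℝ)..t, auxMeanDrift σ (m s) (ν s) (V s) := by
    rw [em, h.m_zero]; ring
  rw [hm]
  calc _ = (∫ s in (0 : ℝ)..t, (-x s.toNNReal ω ^ 3 + x s.toNNReal ω - μ s)) -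
        (∫ s in (0 : ℝ)..t, auxMeanDrift σ (m s) (ν s) (V s)) -
        σ * ∫ s in (0 : ℝ)..t, (1 - 3 * m s ^ 2 - 3 * σ ^ 2 * V s) * z s.toNNReal ω := by ring
    _ = ∫ s in (0 : ℝ)..t, ((-x s.toNNReal ω ^ 3 + x s.toNNReal ω - μ s) -
        auxMeanDrift σ (m s) (ν s) (V s) -
        σ * ((1 - 3 * m s ^ 2 - 3 * σ ^ 2 * V s) * z s.toNNReal ω)) := by
      rw [intervalIntegral.integral_sub ((d1 t).sub im) ((d2 t).const_mul σ),
        intervalIntegral.integral_sub (d1 t) im, intervalIntegral.integral_const_mul]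
    _ = _ := by
      refine intervalIntegral.integral_congr fun s hs ↦ ?_
      rw [uIcc_of_le t.coe_nonneg] at hs
      simp only [gaussApprox, driftGap, closureError, auxMeanDrift, Real.coe_toNNReal s hs.1]
      ring

end

/-! ### Comparison of the McKean–Vlasov process with its Gaussian approximation -/

/-- Here time is integrated first. This suits quantities involving `x`, which are controlled
pathwise rather than by moments uniform in time. -/
lemma integrable_uncurry_of_ae_integral_abs_le {Ω : Type*} [MeasurableSpace Ω] {P : Measure Ω}
    [SFinite P] {ρ : Measure ℝ} [SFinite ρ] {f : ℝ × Ω → ℝ} {G : Ω → ℝ}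
    (hf : AEStronglyMeasurable f (ρ.prod P))
    (hi : ∀ᵐ ω ∂P, Integrable (fun s ↦ f (s, ω)) ρ) (hG : Integrable G P)
    (h : ∀ᵐ ω ∂P, ∫ s, |f (s, ω)| ∂ρ ≤ G ω) : Integrable f (ρ.prod P) := by
  refine (integrable_prod_iff' hf).2 ⟨hi, hG.mono' hf.norm.prod_swap.integral_prod_right' ?_⟩
  filter_upwards [h] with ω hω
  rw [Real.norm_of_nonneg (integral_nonneg fun _ ↦ norm_nonneg _)]
  exact hω

/-- A bound for `σ⁻² E|closureError|` on `[0, T]`. -/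
noncomputable def closureConst (α θ x₀ μ₀ T : ℝ) : ℝ :=
  6 * (1 + auxBound α θ x₀ μ₀ T) * Real.exp (3 * T) +
    Real.exp (3 * T) * (2 + 3 * Real.exp (3 * T))

lemma closureConst_nonneg (α θ x₀ μ₀ T : ℝ) : 0 ≤ closureConst α θ x₀ μ₀ T := by
  have := auxBound_pos α θ x₀ μ₀ T
  unfold closureConst
  positivity

section

variable {Ω : Type*} [MeasurableSpace Ω] {P : Measure Ω} {α θ σ x₀ μ₀ : ℝ} {m ν V μ : ℝ → ℝ}
  {B x z : ℝ≥0 → Ω → ℝ}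

lemma measurable_driftGap (hz : IsLinearSolution σ m V P B z) (t : ℝ≥0) :
    Measurable (driftGap σ m ν V μ z t) := by
  have := hz.measurable t
  unfold driftGap closureError
  fun_prop

lemma measurable_gaussApprox (hz : IsLinearSolution σ m V P B z) (t : ℝ≥0) :
    Measurable (gaussApprox σ m z t) := by
  have := hz.measurable t
  unfold gaussApprox
  fun_prop

lemma ae_abs_sub_gaussApprox_le (h : IsAuxSolution α θ σ x₀ μ₀ m ν V)
    (hz : IsLinearSolution σ m V P B z) (hx : IsMcKeanVlasovSolution α θ σ x₀ μ₀ P B x μ) :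
    ∀ᵐ ω ∂P, ∀ t : ℝ≥0, |x t ω - gaussApprox σ m z t ω| ≤
      Real.exp t * ∫ s in (0 : ℝ)..t, |driftGap σ m ν V μ z s.toNNReal ω| := by
  filter_upwards [ae_sub_gaussApprox_eq h hz hx] with ω ⟨c1, c2, e⟩ t
  have := abs_sub_le_exp_mul_integral (T := t)
    (x := fun s ↦ x s.toNNReal ω) (y := fun s ↦ gaussApprox σ m z s.toNNReal ω)
    (r := fun s ↦ driftGap σ m ν V μ z s.toNNReal ω)
    (c1.comp continuous_real_toNNReal).continuousOn
    ((continuous_gaussApprox h c2).comp continuous_real_toNNReal).continuousOn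
    ((continuous_driftGap h hx.continuousOn_μ c2).comp continuous_real_toNNReal).continuousOn
    (fun t ht ↦ e t ht.1) t ⟨t.coe_nonneg, le_rfl⟩
  simpa using this

end

/-! ### Joint integrability in time and `ω` -/

section

variable {Ω : Type*} [MeasurableSpace Ω] {P : Measure Ω} [IsProbabilityMeasure P]
  {α θ σ x₀ μ₀ : ℝ} {m ν V μ : ℝ → ℝ} {B x z : ℝ≥0 → Ω → ℝ} {T : ℝ≥0}

lemma integrable_driftGap (h : IsAuxSolution α θ σ x₀ μ₀ m ν V)
    (hz : IsLinearSolution σ m V P B z) (hB : IsBrownianReal B P) (μ : ℝ → ℝ) (t : ℝ≥0) :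
    Integrable (driftGap σ m ν V μ z t) P :=
  (integrable_const _).add (integrable_closureError (hz.hasLaw h hB t) _ _ _)

lemma integral_abs_driftGap_le (h : IsAuxSolution α θ σ x₀ μ₀ m ν V)
    (hz : IsLinearSolution σ m V P B z) (hB : IsBrownianReal B P) (hα : 0 ≤ α) (hθ : 0 ≤ θ)
    (hσ : 0 < σ) (μ : ℝ → ℝ) {t : ℝ≥0} (ht : t ≤ T) :
    ∫ ω, |driftGap σ m ν V μ z t ω| ∂P ≤
      |μ t - ν t| + closureConst α θ x₀ μ₀ T * σ ^ 2 := by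
  have hi := (integrable_closureError (hz.hasLaw h hB t) σ (m t) (V t))
  obtain ⟨b1, b2, b3, b4⟩ := h.bounds hα hθ hσ t.coe_nonneg
  have htT : (t : ℝ) ≤ T := ht
  have hexp : Real.exp (3 * t) ≤ Real.exp (3 * T) := Real.exp_le_exp.2 (by linarith)
  have hmono := auxBound_mono hα hθ x₀ μ₀ htT
  have hm : |m t| ≤ 1 + auxBound α θ x₀ μ₀ T := by
    nlinarith [sq_abs (m t), sq_nonneg (|m t| - 1)]
  calc ∫ ω, |driftGap σ m ν V μ z t ω| ∂P
      ≤ ∫ ω, (|μ t - ν t| + |closureError σ (m t) (V t) (z t ω)|) ∂P :=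
        integral_mono (integrable_driftGap h hz hB μ t).abs ((integrable_const _).add hi.abs)
          fun ω ↦ abs_add_le _ _
    _ = |μ t - ν t| + ∫ ω, |closureError σ (m t) (V t) (z t ω)| ∂P := by
        rw [integral_add (integrable_const _) hi.abs]; simp
    _ ≤ _ := by
        gcongr
        exact integral_abs_closureError_le (hz.hasLaw h hB t) hσ hm b1 (b2.trans hexp)
          (b3.trans hexp)

lemma integrable_uncurry_driftGap (h : IsAuxSolution α θ σ x₀ μ₀ m ν V)
    (hz : IsLinearSolution σ m V P B z) (hB : IsBrownianReal B P) (hα : 0 ≤ α) (hθ : 0 ≤ θ)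
    (hσ : 0 < σ) (hμ : ContinuousOn μ (Ici 0)) :
    Integrable (fun p : ℝ × Ω ↦ driftGap σ m ν V μ z p.1.toNNReal p.2)
      ((volume.restrict (Ioc 0 (T : ℝ))).prod P) := by
  have hq : ContinuousOn (fun t ↦ |μ t - ν t|) (Icc 0 T) :=
    ((hμ.sub h.continuousOn_ν).mono Icc_subset_Ici_self).abs
  obtain ⟨K, hK⟩ := isCompact_Icc.bddAbove_image hq
  refine integrable_uncurry_of_integral_abs_le (C := K + closureConst α θ x₀ μ₀ T * σ ^ 2)
    (aestronglyMeasurable_uncurry_of_continuous_paths (measurable_driftGap hz) ?_ _)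
    (fun u _ ↦ integrable_driftGap h hz hB μ u.toNNReal) fun u hu ↦ ?_
  · filter_upwards [hz.continuous_paths] with ω hω using continuous_driftGap h hμ hω
  · refine (integral_abs_driftGap_le h hz hB hα hθ hσ μ (t := u.toNNReal) (T := T)
      (Real.toNNReal_le_iff_le_coe.2 hu.2)).trans ?_
    rw [Real.coe_toNNReal u hu.1.le]
    gcongr
    exact hK ⟨u, ⟨hu.1.le, hu.2⟩, rfl⟩

lemma integrable_uncurry_gaussApprox_sq (h : IsAuxSolution α θ σ x₀ μ₀ m ν V)
    (hz : IsLinearSolution σ m V P B z) (hB : IsBrownianReal B P) (hα : 0 ≤ α) (hθ : 0 ≤ θ)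
    (hσ : 0 < σ) :
    Integrable (fun p : ℝ × Ω ↦ gaussApprox σ m z p.1.toNNReal p.2 ^ 2)
      ((volume.restrict (Ioc 0 (T : ℝ))).prod P) := by
  have hq : ContinuousOn (fun t ↦ m t ^ 2 + σ ^ 2 * V t) (Icc 0 T) :=
    ((h.continuousOn_m.pow 2).add (continuousOn_const.mul h.continuousOn_V)).mono
      Icc_subset_Ici_self
  obtain ⟨K, hK⟩ := isCompact_Icc.bddAbove_image hq
  refine integrable_uncurry_of_integral_abs_le (C := K)
    (f := fun p : ℝ × Ω ↦ gaussApprox σ m z p.1.toNNReal p.2 ^ 2)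
    (aestronglyMeasurable_uncurry_of_continuous_paths (X := fun t ω ↦ gaussApprox σ m z t ω ^ 2)
      (fun t ↦ (measurable_gaussApprox hz t).pow_const 2) ?_ _)
    (fun u _ ↦ integrable_gaussApprox_pow hz h hB 2 u.toNNReal) fun u hu ↦ ?_
  · filter_upwards [hz.continuous_paths] with ω hω using (continuous_gaussApprox h hω).pow 2
  · simp only [abs_pow, sq_abs]
    have := (moment_at_gaussApprox hz h hB (fun t ht ↦ (h.bounds hα hθ hσ ht).1) hu.1.le).2.2.1
    rw [moment_at] at this
    rw [this]
    exact hK ⟨u, ⟨hu.1.le, hu.2⟩, rfl⟩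

lemma integrable_uncurry_sub_gaussApprox (h : IsAuxSolution α θ σ x₀ μ₀ m ν V)
    (hz : IsLinearSolution σ m V P B z) (hB : IsBrownianReal B P) (hα : 0 ≤ α) (hθ : 0 ≤ θ)
    (hσ : 0 < σ) (hx : IsMcKeanVlasovSolution α θ σ x₀ μ₀ P B x μ) :
    Integrable (fun p : ℝ × Ω ↦ x p.1.toNNReal p.2 - gaussApprox σ m z p.1.toNNReal p.2)
      ((volume.restrict (Ioc 0 (T : ℝ))).prod P) := by
  have hr := (integrable_uncurry_driftGap (T := T) h hz hB hα hθ hσ hx.continuousOn_μ).norm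
  refine integrable_uncurry_of_ae_integral_abs_le
    (aestronglyMeasurable_uncurry_of_continuous_paths (X := fun t ω ↦ x t ω - gaussApprox σ m z t ω)
      (fun t ↦ (hx.sde.measurable t).sub (measurable_gaussApprox hz t)) ?_ _) ?_
    (hr.integral_prod_right.const_mul (T * Real.exp T)) ?_
  · filter_upwards [ae_sub_gaussApprox_eq h hz hx] with ω ⟨c1, c2, e⟩
    exact c1.sub (continuous_gaussApprox h c2)
  · filter_upwards [ae_sub_gaussApprox_eq h hz hx] with ω ⟨c1, c2, e⟩
    have hc : Continuous fun s : ℝ ↦ x s.toNNReal ω - gaussApprox σ m z s.toNNReal ω :=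
      (c1.sub (continuous_gaussApprox h c2)).comp continuous_real_toNNReal
    exact (hc.intervalIntegrable 0 T).1
  · filter_upwards [ae_sub_gaussApprox_eq h hz hx, ae_abs_sub_gaussApprox_le h hz hx] with ω
      ⟨c1, c2, e⟩ hle
    have hrc := ((continuous_driftGap h hx.continuousOn_μ c2).comp continuous_real_toNNReal).abs
    rw [← intervalIntegral.integral_of_le T.coe_nonneg, ← intervalIntegral.integral_of_le T.coe_nonneg]
    calc _ ≤ ∫ _s in (0 : ℝ)..T, Real.exp T *
          ∫ u in (0 : ℝ)..T, ‖driftGap σ m ν V μ z u.toNNReal ω‖ := by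
          refine intervalIntegral.integral_mono_on T.coe_nonneg
            (((c1.sub (continuous_gaussApprox h c2)).comp
              continuous_real_toNNReal).abs.intervalIntegrable _ _)
            intervalIntegrable_const fun s hs ↦ (hle s.toNNReal).trans ?_
          rw [Real.coe_toNNReal s hs.1]
          gcongr
          · exact intervalIntegral.integral_nonneg hs.1 fun _ _ ↦ abs_nonneg _
          · exact hs.2
          · exact intervalIntegral.integral_mono_interval le_rfl hs.1 hs.2
              (Filter.Eventually.of_forall fun _ ↦ abs_nonneg _) (hrc.intervalIntegrable _ _)
      _ = _ := by
          rw [intervalIntegral.integral_const]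
          simp only [sub_zero, smul_eq_mul]
          ring

/-- The pathwise energy estimate dominates the time integral by those of `|x - y|`, `|driftGap|` and
`y²`, which are already known to be jointly integrable. -/
lemma integrable_uncurry_cube_sub_cube (h : IsAuxSolution α θ σ x₀ μ₀ m ν V)
    (hz : IsLinearSolution σ m V P B z) (hB : IsBrownianReal B P) (hα : 0 ≤ α) (hθ : 0 ≤ θ)
    (hσ : 0 < σ) (hx : IsMcKeanVlasovSolution α θ σ x₀ μ₀ P B x μ) :
    Integrable (fun p : ℝ × Ω ↦ x p.1.toNNReal p.2 ^ 3 - gaussApprox σ m z p.1.toNNReal p.2 ^ 3)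
      ((volume.restrict (Ioc 0 (T : ℝ))).prod P) := by
  have hr := (integrable_uncurry_driftGap (T := T) h hz hB hα hθ hσ hx.continuousOn_μ).norm
  have hD := (integrable_uncurry_sub_gaussApprox (T := T) h hz hB hα hθ hσ hx).norm
  have hy := (integrable_uncurry_gaussApprox_sq (T := T) h hz hB hα hθ hσ)
  refine integrable_uncurry_of_ae_integral_abs_le
    (aestronglyMeasurable_uncurry_of_continuous_paths
      (X := fun t ω ↦ x t ω ^ 3 - gaussApprox σ m z t ω ^ 3)
      (fun t ↦ ((hx.sde.measurable t).pow_const 3).sub ((measurable_gaussApprox hz t).pow_const 3))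
      ?_ _) ?_
    (((hD.add hr).integral_prod_right.const_mul 2).add
      (((integrable_const 3).add (hy.const_mul 5)).integral_prod_right)) ?_
  · filter_upwards [ae_sub_gaussApprox_eq h hz hx] with ω ⟨c1, c2, e⟩
    exact (c1.pow 3).sub ((continuous_gaussApprox h c2).pow 3)
  · filter_upwards [ae_sub_gaussApprox_eq h hz hx] with ω ⟨c1, c2, e⟩
    have hc : Continuous fun s : ℝ ↦ x s.toNNReal ω ^ 3 - gaussApprox σ m z s.toNNReal ω ^ 3 :=
      ((c1.pow 3).sub ((continuous_gaussApprox h c2).pow 3)).comp continuous_real_toNNReal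
    exact (hc.intervalIntegrable 0 T).1
  · filter_upwards [ae_sub_gaussApprox_eq h hz hx] with ω ⟨c1, c2, e⟩
    have := integral_abs_cube_sub_cube_le (T := T) T.coe_nonneg
      (x := fun s ↦ x s.toNNReal ω) (y := fun s ↦ gaussApprox σ m z s.toNNReal ω)
      (r := fun s ↦ driftGap σ m ν V μ z s.toNNReal ω)
      (c1.comp continuous_real_toNNReal).continuousOn
      ((continuous_gaussApprox h c2).comp continuous_real_toNNReal).continuousOn
      ((continuous_driftGap h hx.continuousOn_μ c2).comp continuous_real_toNNReal).continuousOn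
      (fun t ht ↦ e t ht.1)
    simp only [intervalIntegral.integral_of_le T.coe_nonneg] at this
    exact this

end

/-- The primitive `f = ∫|q|` satisfies `f' ≤ K f + L`, to which the differential form applies. -/
lemma abs_le_of_abs_le_integral {q : ℝ → ℝ} {T K L : ℝ} (hq : ContinuousOn q (Icc 0 T))
    (hK : 0 ≤ K) (hL : 0 ≤ L)
    (h : ∀ t ∈ Icc 0 T, |q t| ≤ K * (∫ s in (0 : ℝ)..t, |q s|) + L) :
    ∀ t ∈ Icc 0 T, |q t| ≤ K * (Real.exp (K * T) * (T * L)) + L := by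
  intro t ht
  have h1 := le_exp_mul_integral (f := fun t ↦ ∫ s in (0 : ℝ)..t, |q s|) (h := fun _ ↦ L) hK
    (fun t ht ↦ hasDerivWithinAt_integral_Icc hq.abs ht) (by simp) continuousOn_const
    (fun _ _ ↦ hL) (fun t ht _ ↦ h t ht) t ht
  rw [intervalIntegral.integral_const, sub_zero, smul_eq_mul] at h1
  refine (h t ht).trans ?_
  have h2 : Real.exp (K * t) * (t * L) ≤ Real.exp (K * T) * (T * L) := by
    gcongr
    · exact mul_nonneg ht.1 hL
    · exact ht.2
    · exact ht.2
  gcongr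
  exact h1.trans h2

/-! ### The equation for `μ - ν` and the final estimate -/

section

variable {Ω : Type*} [MeasurableSpace Ω] {P : Measure Ω} [IsProbabilityMeasure P]
  {α θ σ x₀ μ₀ : ℝ} {m ν V μ : ℝ → ℝ} {B x z : ℝ≥0 → Ω → ℝ}

/-- The nonlinear terms in `z` cancel between `y³` and the closure error, leaving a term linear in
`z` of mean zero. Of `x`, only the combination `x³ - x` needs to be integrable. -/
lemma integral_drift_sub (h : IsAuxSolution α θ σ x₀ μ₀ m ν V)
    (hz : IsLinearSolution σ m V P B z) (hB : IsBrownianReal B P)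
    (hx : IsMcKeanVlasovSolution α θ σ x₀ μ₀ P B x μ) (s : ℝ≥0) :
    ∫ ω, (-(x s ω ^ 3 - gaussApprox σ m z s ω ^ 3) + (x s ω - gaussApprox σ m z s ω) -
      driftGap σ m ν V μ z s ω) ∂P =
      -(∫ ω, (x s ω ^ 3 - x s ω) ∂P) - μ s - auxMeanDrift σ (m s) (ν s) (V s) := by
  have hlaw := hz.hasLaw h hB s
  have iz : Integrable (z s) P := by simpa using integrable_pow_of_hasLaw_gaussianReal hlaw 1
  have e : ∀ ω, -(x s ω ^ 3 - gaussApprox σ m z s ω ^ 3) + (x s ω - gaussApprox σ m z s ω) -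
      driftGap σ m ν V μ z s ω = -(x s ω ^ 3 - x s ω) +
        (-(μ s + auxMeanDrift σ (m s) (ν s) (V s))) -
          σ * (1 - 3 * m s ^ 2 - 3 * σ ^ 2 * V s) * z s ω := fun ω ↦ by
    simp only [gaussApprox, driftGap, closureError, auxMeanDrift]
    ring
  have i1 : Integrable (fun ω ↦ -(x s ω ^ 3 - x s ω)) P := (hx.integrable s).neg
  have i2 : Integrable (fun ω ↦ -(x s ω ^ 3 - x s ω) +
      (-(μ s + auxMeanDrift σ (m s) (ν s) (V s)))) P := i1.add (integrable_const _)
  simp_rw [e]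
  rw [integral_sub i2 (iz.const_mul _),
    integral_add i1 (integrable_const _), integral_neg, integral_const_mul,
    (gaussianReal_moments hlaw).1]
  simp only [integral_const, probReal_univ, one_smul]
  ring

/-- Fubini applies by the joint integrability of the three parts of the drift. It also yields the
time integrability of `E[x³ - x]`, needed to integrate the equation for `μ`. -/
lemma integral_sub_gaussApprox (h : IsAuxSolution α θ σ x₀ μ₀ m ν V)
    (hz : IsLinearSolution σ m V P B z) (hB : IsBrownianReal B P) (hα : 0 ≤ α) (hθ : 0 ≤ θ)
    (hσ : 0 < σ) (hx : IsMcKeanVlasovSolution α θ σ x₀ μ₀ P B x μ) (t : ℝ≥0) :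
    IntervalIntegrable (fun s : ℝ ↦ -(∫ ω, (x s.toNNReal ω ^ 3 - x s.toNNReal ω) ∂P) - μ s -
      auxMeanDrift σ (m s) (ν s) (V s)) volume 0 t ∧
    ∫ ω, (x t ω - gaussApprox σ m z t ω) ∂P =
      ∫ s in (0 : ℝ)..t, (-(∫ ω, (x s.toNNReal ω ^ 3 - x s.toNNReal ω) ∂P) - μ s -
        auxMeanDrift σ (m s) (ν s) (V s)) := by
  have hr := integrable_uncurry_driftGap (T := t) h hz hB hα hθ hσ hx.continuousOn_μ
  have hD := integrable_uncurry_sub_gaussApprox (T := t) h hz hB hα hθ hσ hx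
  have hκ := integrable_uncurry_cube_sub_cube (T := t) h hz hB hα hθ hσ hx
  have hg := (hκ.neg.add hD).sub hr
  have key : ∀ s ∈ Ioc (0 : ℝ) t, ∫ ω, (-(x s.toNNReal ω ^ 3 - gaussApprox σ m z s.toNNReal ω ^ 3) +
      (x s.toNNReal ω - gaussApprox σ m z s.toNNReal ω) -
        driftGap σ m ν V μ z s.toNNReal ω) ∂P =
      -(∫ ω, (x s.toNNReal ω ^ 3 - x s.toNNReal ω) ∂P) - μ s -
        auxMeanDrift σ (m s) (ν s) (V s) := fun s hs ↦ by
    have := integral_drift_sub h hz hB hx s.toNNReal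
    rwa [Real.coe_toNNReal s hs.1.le] at this
  constructor
  · rw [intervalIntegrable_iff_integrableOn_Ioc_of_le t.coe_nonneg]
    refine hg.integral_prod_left.congr ?_
    filter_upwards [ae_restrict_mem measurableSet_Ioc] with s hs using key s hs
  · calc _ = ∫ ω, (∫ s in Ioc (0 : ℝ) t,
          (-(x s.toNNReal ω ^ 3 - gaussApprox σ m z s.toNNReal ω ^ 3) +
            (x s.toNNReal ω - gaussApprox σ m z s.toNNReal ω) -
              driftGap σ m ν V μ z s.toNNReal ω)) ∂P := by
          refine integral_congr_ae ?_
          filter_upwards [ae_sub_gaussApprox_eq h hz hx] with ω hω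
          have := hω.2.2 t t.coe_nonneg
          rwa [intervalIntegral.integral_of_le t.coe_nonneg, Real.toNNReal_coe] at this
      _ = ∫ s in Ioc (0 : ℝ) t, ∫ ω,
          (-(x s.toNNReal ω ^ 3 - gaussApprox σ m z s.toNNReal ω ^ 3) +
            (x s.toNNReal ω - gaussApprox σ m z s.toNNReal ω) -
              driftGap σ m ν V μ z s.toNNReal ω) ∂P := (integral_integral_swap hg).symm
      _ = _ := by
          rw [intervalIntegral.integral_of_le t.coe_nonneg]
          exact setIntegral_congr_fun measurableSet_Ioc key

/-- Both equations have the form `-α · - θ (mean)'`. Integrating their difference removes the cubic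
expectation in favour of `E[x - y]`. -/
lemma sub_eq_integral (h : IsAuxSolution α θ σ x₀ μ₀ m ν V)
    (hz : IsLinearSolution σ m V P B z) (hB : IsBrownianReal B P) (hα : 0 ≤ α) (hθ : 0 ≤ θ)
    (hσ : 0 < σ) (hx : IsMcKeanVlasovSolution α θ σ x₀ μ₀ P B x μ) (t : ℝ≥0) :
    μ t - ν t = -α * (∫ s in (0 : ℝ)..t, (μ s - ν s)) -
      θ * ∫ ω, (x t ω - gaussApprox σ m z t ω) ∂P := by
  obtain ⟨hi, he⟩ := integral_sub_gaussApprox h hz hB hα hθ hσ hx t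
  have hd : ∀ s : ℝ, 0 ≤ s → HasDerivWithinAt (fun s ↦ μ s - ν s) (-α * (μ s - ν s) -
      θ * (-(∫ ω, (x s.toNNReal ω ^ 3 - x s.toNNReal ω) ∂P) - μ s -
        auxMeanDrift σ (m s) (ν s) (V s))) (Ici 0) s := fun s hs ↦ by
    have h1 := hx.μ_deriv s.toNNReal
    rw [Real.coe_toNNReal s hs] at h1
    exact (h1.fun_sub (h.ν_deriv s hs)).congr_deriv (by ring)
  have hq : IntervalIntegrable (fun s ↦ μ s - ν s) volume 0 t :=
    ((hx.continuousOn_μ.sub h.continuousOn_ν).mono (by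
      rw [uIcc_of_le t.coe_nonneg]; exact Icc_subset_Ici_self)).intervalIntegrable
  have := integral_eq_sub_of_hasDerivWithinAt_Ici hd t.coe_nonneg
    ((hq.const_mul _).sub (hi.const_mul _))
  rw [intervalIntegral.integral_sub (hq.const_mul _) (hi.const_mul _),
    intervalIntegral.integral_const_mul, intervalIntegral.integral_const_mul, ← he, hx.μ_zero,
    h.ν_zero] at this
  linarith

lemma integral_integral_abs_driftGap_le (h : IsAuxSolution α θ σ x₀ μ₀ m ν V)
    (hz : IsLinearSolution σ m V P B z) (hB : IsBrownianReal B P) (hα : 0 ≤ α) (hθ : 0 ≤ θ)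
    (hσ : 0 < σ) (hx : IsMcKeanVlasovSolution α θ σ x₀ μ₀ P B x μ) {t T : ℝ≥0} (ht : t ≤ T) :
    Integrable (fun ω ↦ ∫ s in (0 : ℝ)..t, |driftGap σ m ν V μ z s.toNNReal ω|) P ∧
    ∫ ω, (∫ s in (0 : ℝ)..t, |driftGap σ m ν V μ z s.toNNReal ω|) ∂P ≤
      (∫ s in (0 : ℝ)..t, |μ s - ν s|) + T * (closureConst α θ x₀ μ₀ T * σ ^ 2) := by
  have hr := (integrable_uncurry_driftGap (T := t) h hz hB hα hθ hσ hx.continuousOn_μ).norm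
  have htT : (t : ℝ) ≤ T := ht
  have hc := closureConst_nonneg α θ x₀ μ₀ T
  have hq : IntervalIntegrable (fun s ↦ |μ s - ν s|) volume 0 t :=
    ((hx.continuousOn_μ.sub h.continuousOn_ν).mono (by
      rw [uIcc_of_le t.coe_nonneg]; exact Icc_subset_Ici_self)).abs.intervalIntegrable
  have hri : IntervalIntegrable
      (fun s : ℝ ↦ ∫ ω, |driftGap σ m ν V μ z s.toNNReal ω| ∂P) volume 0 t := by
    rw [intervalIntegrable_iff_integrableOn_Ioc_of_le t.coe_nonneg]
    exact hr.integral_prod_left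
  simp only [intervalIntegral.integral_of_le t.coe_nonneg (f := fun s : ℝ ↦
    |driftGap σ m ν V μ z s.toNNReal _|)]
  refine ⟨hr.integral_prod_right, ?_⟩
  calc _ = ∫ s in (0 : ℝ)..t, ∫ ω, |driftGap σ m ν V μ z s.toNNReal ω| ∂P := by
        rw [intervalIntegral.integral_of_le t.coe_nonneg]
        exact (integral_integral_swap hr).symm
    _ ≤ ∫ s in (0 : ℝ)..t, (|μ s - ν s| + closureConst α θ x₀ μ₀ T * σ ^ 2) := by
        refine intervalIntegral.integral_mono_on t.coe_nonneg hri
          (hq.add intervalIntegrable_const) fun s hs ↦ ?_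
        have := integral_abs_driftGap_le h hz hB hα hθ hσ μ (t := s.toNNReal) (T := T)
          (Real.toNNReal_le_iff_le_coe.2 (hs.2.trans htT))
        rwa [Real.coe_toNNReal s hs.1] at this
    _ = (∫ s in (0 : ℝ)..t, |μ s - ν s|) + t * (closureConst α θ x₀ μ₀ T * σ ^ 2) := by
        rw [intervalIntegral.integral_add hq intervalIntegrable_const,
          intervalIntegral.integral_const, sub_zero, smul_eq_mul]
    _ ≤ _ := by gcongr

/-- The constant in the bound for `|μ - ν|` on `[0, T]`. -/
noncomputable def meanGapConst (α θ x₀ μ₀ T : ℝ) : ℝ :=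
  (α + θ * Real.exp T) * (Real.exp ((α + θ * Real.exp T) * T) *
    (T * (θ * Real.exp T * (T * closureConst α θ x₀ μ₀ T)))) +
      θ * Real.exp T * (T * closureConst α θ x₀ μ₀ T)

/-- Inserting `E|x - y| ≤ exp(T) (∫|μ - ν| + T c σ²)`, with `c` the closure constant, into the
integral equation gives Gronwall's inequality with `K = α + θ exp(T)` and `L = θ exp(T) T c σ²`. -/
lemma abs_sub_le_meanGapConst (h : IsAuxSolution α θ σ x₀ μ₀ m ν V)
    (hz : IsLinearSolution σ m V P B z) (hB : IsBrownianReal B P) (hα : 0 ≤ α) (hθ : 0 ≤ θ)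
    (hσ : 0 < σ) (hx : IsMcKeanVlasovSolution α θ σ x₀ μ₀ P B x μ) {t T : ℝ≥0} (ht : t ≤ T) :
    |μ t - ν t| ≤ meanGapConst α θ x₀ μ₀ T * σ ^ 2 := by
  have hc := closureConst_nonneg α θ x₀ μ₀ T
  have key := abs_le_of_abs_le_integral (q := fun s ↦ μ s - ν s) (T := T)
    (K := α + θ * Real.exp T)
    (L := θ * Real.exp T * (T * (closureConst α θ x₀ μ₀ T * σ ^ 2)))
    ((hx.continuousOn_μ.sub h.continuousOn_ν).mono Icc_subset_Ici_self) (by positivity)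
    (by positivity) ?_ t ⟨t.coe_nonneg, ht⟩
  · refine key.trans (le_of_eq ?_)
    rw [meanGapConst]
    ring
  · intro s hs
    lift s to ℝ≥0 using hs.1
    obtain ⟨hi, hle⟩ := integral_integral_abs_driftGap_le h hz hB hα hθ hσ hx
      (t := s) (T := T) hs.2
    have hexp : Real.exp s ≤ Real.exp T := Real.exp_le_exp.2 hs.2
    have hD : |∫ ω, (x s ω - gaussApprox σ m z s ω) ∂P| ≤ Real.exp T *
        ((∫ u in (0 : ℝ)..s, |μ u - ν u|) + T * (closureConst α θ x₀ μ₀ T * σ ^ 2)) := by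
      calc _ ≤ ∫ ω, Real.exp s * (∫ u in (0 : ℝ)..s, |driftGap σ m ν V μ z u.toNNReal ω|) ∂P := by
            refine norm_integral_le_of_norm_le (G := ℝ) (hi.const_mul (Real.exp s)) ?_
            filter_upwards [ae_abs_sub_gaussApprox_le h hz hx] with ω hω using hω s
        _ = Real.exp s *
            ∫ ω, (∫ u in (0 : ℝ)..s, |driftGap σ m ν V μ z u.toNNReal ω|) ∂P :=
            integral_const_mul _ _
        _ ≤ _ := by
            gcongr
            exact integral_nonneg fun ω ↦
              intervalIntegral.integral_nonneg s.coe_nonneg fun _ _ ↦ abs_nonneg _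
    have hint : |∫ u in (0 : ℝ)..s, (μ u - ν u)| ≤ ∫ u in (0 : ℝ)..s, |μ u - ν u| :=
      intervalIntegral.abs_integral_le_integral_abs s.coe_nonneg
    rw [sub_eq_integral h hz hB hα hθ hσ hx s]
    calc _ ≤ |-α * ∫ u in (0 : ℝ)..s, (μ u - ν u)| +
          |θ * ∫ ω, (x s ω - gaussApprox σ m z s ω) ∂P| := abs_sub _ _
      _ = α * |∫ u in (0 : ℝ)..s, (μ u - ν u)| +
          θ * |∫ ω, (x s ω - gaussApprox σ m z s ω) ∂P| := by
          rw [abs_mul, abs_mul, abs_neg, abs_of_nonneg hα, abs_of_nonneg hθ]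
      _ ≤ α * (∫ u in (0 : ℝ)..s, |μ u - ν u|) + θ * (Real.exp T *
          ((∫ u in (0 : ℝ)..s, |μ u - ν u|) + T * (closureConst α θ x₀ μ₀ T * σ ^ 2))) := by
          gcongr
      _ = _ := by ring

/-- The supremum is dominated pathwise by `exp(T) ∫|driftGap|`, which is integrable. Measurability
of the supremum itself is not needed for the lower integral. -/
lemma lintegral_iSup_add_iSup_le (h : IsAuxSolution α θ σ x₀ μ₀ m ν V)
    (hz : IsLinearSolution σ m V P B z) (hB : IsBrownianReal B P) (hα : 0 ≤ α) (hθ : 0 ≤ θ)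
    (hσ : 0 < σ) (hx : IsMcKeanVlasovSolution α θ σ x₀ μ₀ P B x μ) (T : ℝ≥0) :
    (∫⁻ ω, ⨆ t ∈ Icc (0 : ℝ≥0) T, ‖x t ω - gaussApprox σ m z t ω‖ₑ ∂P)
      + (⨆ t ∈ Icc (0 : ℝ≥0) T, ‖μ t - ν t‖ₑ) ≤
      ENNReal.ofReal ((Real.exp T * (T * (meanGapConst α θ x₀ μ₀ T + closureConst α θ x₀ μ₀ T)) +
        meanGapConst α θ x₀ μ₀ T) * σ ^ 2) := by
  obtain ⟨hi, hle⟩ := integral_integral_abs_driftGap_le h hz hB hα hθ hσ hx (t := T) le_rfl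
  have hgap := fun (t : ℝ≥0) (ht : t ≤ T) ↦ abs_sub_le_meanGapConst h hz hB hα hθ hσ hx ht
  have hG0 : 0 ≤ meanGapConst α θ x₀ μ₀ T * σ ^ 2 := (abs_nonneg _).trans (hgap 0 bot_le)
  have hc := closureConst_nonneg α θ x₀ μ₀ T
  have hnn : ∀ ω, 0 ≤ ∫ s in (0 : ℝ)..T, |driftGap σ m ν V μ z s.toNNReal ω| := fun ω ↦
    intervalIntegral.integral_nonneg T.coe_nonneg fun _ _ ↦ abs_nonneg _
  have hq : ∫ s in (0 : ℝ)..T, |μ s - ν s| ≤ T * (meanGapConst α θ x₀ μ₀ T * σ ^ 2) := by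
    have h1 : IntervalIntegrable (fun s ↦ |μ s - ν s|) volume 0 T :=
      ((hx.continuousOn_μ.sub h.continuousOn_ν).mono (by
        rw [uIcc_of_le T.coe_nonneg]; exact Icc_subset_Ici_self)).abs.intervalIntegrable
    have := intervalIntegral.integral_mono_on T.coe_nonneg h1
      (intervalIntegrable_const (c := meanGapConst α θ x₀ μ₀ T * σ ^ 2))
      fun s hs ↦ hgap ⟨s, hs.1⟩ hs.2
    rwa [intervalIntegral.integral_const, sub_zero, smul_eq_mul] at this
  have h1 : ∫⁻ ω, ⨆ t ∈ Icc (0 : ℝ≥0) T, ‖x t ω - gaussApprox σ m z t ω‖ₑ ∂P ≤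
      ENNReal.ofReal (Real.exp T * (T * (meanGapConst α θ x₀ μ₀ T * σ ^ 2) +
        T * (closureConst α θ x₀ μ₀ T * σ ^ 2))) := by
    calc _ ≤ ∫⁻ ω, ENNReal.ofReal (Real.exp T *
          ∫ s in (0 : ℝ)..T, |driftGap σ m ν V μ z s.toNNReal ω|) ∂P := by
          refine lintegral_mono_ae ?_
          filter_upwards [ae_abs_sub_gaussApprox_le h hz hx, ae_sub_gaussApprox_eq h hz hx]
            with ω hω ⟨_, c2, _⟩
          refine iSup₂_le fun t ht ↦ ?_
          rw [Real.enorm_eq_ofReal_abs]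
          refine ENNReal.ofReal_le_ofReal ((hω t).trans ?_)
          have htT : (t : ℝ) ≤ T := ht.2
          gcongr
          · exact intervalIntegral.integral_nonneg t.coe_nonneg fun _ _ ↦ abs_nonneg _
          · exact intervalIntegral.integral_mono_interval le_rfl t.coe_nonneg htT
              (Filter.Eventually.of_forall fun _ ↦ abs_nonneg _)
              (((continuous_driftGap h hx.continuousOn_μ c2).comp
                continuous_real_toNNReal).abs.intervalIntegrable _ _)
      _ = ENNReal.ofReal (∫ ω, Real.exp T *
          (∫ s in (0 : ℝ)..T, |driftGap σ m ν V μ z s.toNNReal ω|) ∂P) :=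
          (ofReal_integral_eq_lintegral_ofReal (hi.const_mul _)
            (Filter.Eventually.of_forall fun ω ↦ mul_nonneg (Real.exp_pos _).le (hnn ω))).symm
      _ ≤ _ := by
          rw [integral_const_mul]
          refine ENNReal.ofReal_le_ofReal ?_
          gcongr
          exact hle.trans (by gcongr)
  have h2 : (⨆ t ∈ Icc (0 : ℝ≥0) T, ‖μ t - ν t‖ₑ) ≤
      ENNReal.ofReal (meanGapConst α θ x₀ μ₀ T * σ ^ 2) := by
    refine iSup₂_le fun t ht ↦ ?_
    rw [Real.enorm_eq_ofReal_abs]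
    exact ENNReal.ofReal_le_ofReal (hgap t ht.2)
  refine (add_le_add h1 h2).trans ?_
  rw [← ENNReal.ofReal_add (by positivity) hG0]
  exact ENNReal.ofReal_le_ofReal (le_of_eq (by ring))

end

theorem mainTheorem3 (α θ : ℝ) (hα : 0 ≤ α) (hθ : 0 ≤ θ) (x₀ μ₀ : ℝ) :
    -- the auxiliary system has a global solution
    (∀ σ : ℝ, 0 < σ → ∃ m ν V : ℝ → ℝ, IsAuxSolution α θ σ x₀ μ₀ m ν V) ∧
    (∀ σ : ℝ, 0 < σ → ∀ m ν V : ℝ → ℝ, IsAuxSolution α θ σ x₀ μ₀ m ν V →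
      ∀ (Ω : Type*) [MeasurableSpace Ω] (P : Measure Ω) [IsProbabilityMeasure P]
        (B : ℝ≥0 → Ω → ℝ), (∀ t, Measurable (B t)) → IsBrownianReal B P →
      -- the linear equation has a solution driven by `B`
      (∃ z : ℝ≥0 → Ω → ℝ, IsLinearSolution σ m V P B z) ∧
      ∀ z : ℝ≥0 → Ω → ℝ, IsLinearSolution σ m V P B z →
        -- (a)
        (IsGaussianProcess (gaussApprox σ m z) P ∧ IsMarkovReal (gaussApprox σ m z) P ∧
          (∀ᵐ ω ∂P, gaussApprox σ m z 0 ω = x₀) ∧ ν 0 = μ₀) ∧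
        -- (b)
        (SatisfiesMomentEquations α θ σ P (gaussApprox σ m z) ν 1 ∧
          SatisfiesMomentEquations α θ σ P (gaussApprox σ m z) ν 2)) ∧
    -- (c)
    (∀ T : ℝ≥0, 0 < T → ∃ C : ℝ, ∀ σ : ℝ, 0 < σ →
      ∀ m ν V : ℝ → ℝ, IsAuxSolution α θ σ x₀ μ₀ m ν V →
      ∀ (Ω : Type*) [MeasurableSpace Ω] (P : Measure Ω) [IsProbabilityMeasure P]
        (B : ℝ≥0 → Ω → ℝ), (∀ t, Measurable (B t)) → IsBrownianReal B P →
      ∀ z : ℝ≥0 → Ω → ℝ, IsLinearSolution σ m V P B z →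
      ∀ (x : ℝ≥0 → Ω → ℝ) (μ : ℝ → ℝ), IsMcKeanVlasovSolution α θ σ x₀ μ₀ P B x μ →
        (∫⁻ ω, ⨆ t ∈ Icc (0 : ℝ≥0) T, ‖x t ω - gaussApprox σ m z t ω‖ₑ ∂P)
          + (⨆ t ∈ Icc (0 : ℝ≥0) T, ‖μ t - ν t‖ₑ) ≤ ENNReal.ofReal (C * σ ^ 2)) := by
  refine ⟨fun σ hσ ↦ exists_isAuxSolution hα hθ hσ x₀ μ₀, fun σ hσ m ν V h Ω _ P _ B hBm hB ↦
    ⟨exists_isLinearSolution h.continuousOn_m h.continuousOn_V hBm hB, fun z hz ↦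
      ⟨⟨gaussApprox_isGaussianProcess hz h hB, gaussApprox_isMarkovReal hz h hB,
        gaussApprox_zero hz h hB, h.ν_zero⟩,
        satisfiesMomentEquations hz h hB fun t ht ↦ (h.bounds hα hθ hσ ht).1⟩⟩,
    -- The constant is read off from the final estimate by unification. It is chosen before `σ` and
    -- all the processes, so it depends on `T`, `α`, `θ`, `x₀`, `μ₀` only.
    fun T _ ↦ ⟨_, fun σ hσ m ν V h Ω _ P _ B _ hB z hz x μ hx ↦
      lintegral_iSup_add_iSup_le h hz hB hα hθ hσ hx T⟩⟩
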